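/- **Model.** An instance $\mathcal I$ consists of a finite set of types $\mathcal T$, arrival rates $\lambda_i>0$, abandonment rates $\mu_i>0$ and rewards $r_{ij}\in\mathbb R$ ($i,j\in\mathcal T$). Agents of type $i$ arrive according to a Poisson process of rate $\lambda_i$ on $[0,\infty)$, independently across types. An agent $a$ of type $i_a=i$ who arrives at time $t_a$ has a maximum sojourn time $s_a\sim\mathrm{Exp}(\mu_i)$ (all independent of each other and of the arrivals) and abandons at $d_a=t_a+s_a$ if not matched before. Let $\mathcal A(t)$ be the set of agents who arrive before $t$, let $\mathcal H(t)=\{(i_a,t_a,d_a)\}_{a\in\mathcal A(t)}$, and let $G(t)$ be the graph on $\mathcal A(t)$ in which $a\neq b$ are adjacent iff $[t_a,d_a]\cap[t_b,d_b]\neq\emptyset$. A policy $\pi$ maps each history $\mathcal H(t)$ to a matching of $G(t)$, with no informational constraint. A matched pair with earlier agent $a$ and later agent $b$ earns $r_{i_a i_b}$. For $t>0$ set $$V(\pi,\mathcal I,t)=\frac1t\,\mathbb E\Big[\sum_{(a,b)\in\pi(\mathcal H(t)),\ t_a<t_b} r_{i_ai_b}\Big],\qquad \mathrm{OFF}(\mathcal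 I,t)=\max_\pi V(\pi,\mathcal I,t),\qquad \mathrm{OFF}(\mathcal I)=\lim_{t\to\infty}\mathrm{OFF}(\mathcal I,t),$$ where $\pi$ ranges over the policies whose total reward by time $t$ is an integrable random variable. **Linear programs.** $\mathrm{LP}^{\mathrm{OFF}}(\mathcal I)$ is the maximum of $\sum_{i,j\in\mathcal T}r_{ij}x_{ij}$ over $x\ge 0$ such that for all $j\in\mathcal T$ and $S,S'\subseteq\mathcal T$ $$\sum_{i\in S}x_{ij}+\sum_{i\in S'}x_{ji}\ \le\ \lambda_j\Big(1-\frac{\mu_j}{\mu_j+\sum_{i\in S'}\lambda_i}\,e^{-\sum_{i\in S}\lambda_i/\mu_i}\Big).$$ $\mathrm{LP}^{\mathrm{OFF\text{-}relaxed}}(\mathcal I)$ is the maximum of the same objective over $x\ge0$ such that for all $j\in\mathcal T$ and $S\subseteq\mathcal T$ $$\sum_{i\in\mathcal T}x_{ij}+\sum_{i\in\mathcal T}x_{ji}\le\lambda_j,\qquad \sum_{i\in S}x_{ij}\le\lambda_j\big(1-e^{-\sum_{i\in S}\lambda_i/\mu_i}\big).$$ **Proposition.** For every instance $\mathcal I$,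 all of these maxima (for $\mathrm{OFF}(\mathcal I,t)$, for every $t>0$) are attained, the limit defining $\mathrm{OFF}(\mathcal I)$ exists and is finite, and $$\mathrm{OFF}(\mathcal I)\ \le\ \mathrm{LP}^{\mathrm{OFF}}(\mathcal I)\ \le\ \mathrm{LP}^{\mathrm{OFF\text{-}relaxed}}(\mathcal I).$$ -/

import Mathlib

open MeasureTheory ProbabilityTheory Filter Topology

namespace DynMatch

/-- An instance of the matching problem with abandonment on the set of types `T`.
`reward i j` is the reward of matching an agent of type `i` with a later-arriving agent of
type `j`; it need be neither symmetric nor nonnegative. -/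
structure Instance (T : Type*) where
  arrivalRate : T → ℝ
  abandonRate : T → ℝ
  reward : T → T → ℝ
  arrivalRate_pos : ∀ i, 0 < arrivalRate i
  abandonRate_pos : ∀ i, 0 < abandonRate i

/-- The times between consecutive points of a sequence of arrival times (the first one is counted
from time `0`). -/
def gap {Ω : Type*} (arr : ℕ → Ω → ℝ) : ℕ → Ω → ℝ
  | 0 => arr 0
  | k + 1 => fun ω => arr (k + 1) ω - arr k ω

/-- The random input of the market: `arr i k` is the arrival time of the `k`-th agent of type `i`
and `soj i k` is her maximum sojourn time. For each type `i` the arrivals form a Poisson process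
of rate `λ i` (i.i.d. exponential interarrival times of rate `λ i`), the sojourn times are i.i.d.
exponential of rate `μ i`, and all of these variables, over all types, are independent. -/
structure IsMarketProcess {T Ω : Type*} [MeasurableSpace Ω] (I : Instance T) (P : Measure Ω)
    (arr soj : T → ℕ → Ω → ℝ) : Prop where
  hasLaw_gap : ∀ i k, HasLaw (gap (arr i) k) (expMeasure (I.arrivalRate i)) P
  hasLaw_soj : ∀ i k, HasLaw (soj i k) (expMeasure (I.abandonRate i)) P
  indep : iIndepFun (Sum.elim (fun p : T × ℕ => gap (arr p.1) p.2)
    (fun p : T × ℕ => soj p.1 p.2)) P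

/-- An agent as recorded in the history: the triple `(i_a, t_a, d_a)` of type, arrival time and
time of (unmatched) departure. -/
@[ext]
structure Agent (T : Type*) where
  kind : T
  arrival : ℝ
  departure : ℝ

/-- The history `H(t)`: the set of all agents who arrive before time `t`. -/
def history {T Ω : Type*} (arr soj : T → ℕ → Ω → ℝ) (t : ℝ) (ω : Ω) : Set (Agent T) :=
  {a | ∃ i k, arr i k ω < t ∧ a = ⟨i, arr i k ω, arr i k ω + soj i k ω⟩}

/-- The graph `G(t)` of a history: two different agents are adjacent iff the time intervals during
which they would be present (when unmatched) intersect. -/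
def poolGraph {T : Type*} (H : Set (Agent T)) : SimpleGraph (Agent T) where
  Adj a b := a ∈ H ∧ b ∈ H ∧ a ≠ b ∧
    (Set.Icc a.arrival a.departure ∩ Set.Icc b.arrival b.departure).Nonempty
  symm := ⟨fun a b h => ⟨h.2.1, h.1, h.2.2.1.symm, by
    rw [Set.inter_comm]
    exact h.2.2.2⟩⟩
  loopless := ⟨fun _ h => h.2.2.1 rfl⟩

/-- An (omniscient) policy maps each history to a matching of its graph. There is no
informational constraint, and no consistency across different horizons. -/
structure Policy (T : Type*) where
  choice : (H : Set (Agent T)) → (poolGraph H).Subgraph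
  isMatching : ∀ H, (choice H).IsMatching

/-- The matched pairs `(a, b)`, each written with the earlier-arriving agent `a` first. -/
def Policy.pairs {T : Type*} (π : Policy T) (H : Set (Agent T)) : Set (Agent T × Agent T) :=
  {p | (π.choice H).Adj p.1 p.2 ∧ p.1.arrival < p.2.arrival}

/-- Total reward of the matching that `π` selects for the history `H`. (Almost surely, `H(t)` is
finite and no two agents arrive at the same time.) -/
noncomputable def Policy.totalReward {T : Type*} (π : Policy T) (I : Instance T)
    (H : Set (Agent T)) : ℝ :=
  ∑ᶠ p ∈ π.pairs H, I.reward p.1.kind p.2.kind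

section Market

variable {T Ω : Type*} [MeasurableSpace Ω] (I : Instance T) (P : Measure Ω)
  (arr soj : T → ℕ → Ω → ℝ)

/-- The expected reward rate `V(π, I, t)` of the policy `π` by time `t`. -/
noncomputable def policyValue (π : Policy T) (t : ℝ) : ℝ :=
  1 / t * ∫ ω, π.totalReward I (history arr soj t ω) ∂P

/-- The values `V(π, I, t)` of all the policies `π` whose total reward by time `t` has a
well-defined finite expectation. -/
def policyValues (t : ℝ) : Set ℝ :=
  {v | ∃ π : Policy T, Integrable (fun ω => π.totalReward I (history arr soj t ω)) P ∧
    v = policyValue I P arr soj π t}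

/-- `OFF(I, t)`: the optimal value at horizon `t`. -/
noncomputable def offOptAt (t : ℝ) : ℝ := sSup (policyValues I P arr soj t)

/-- `OFF(I) = lim_{t → ∞} OFF(I, t)`. -/
noncomputable def offOpt : ℝ := limUnder atTop (fun t : ℝ => offOptAt I P arr soj t)

end Market

section LinearPrograms

variable {T : Type*} [Fintype T] (I : Instance T)

/-- The objective `∑_{i,j} r_{ij} x_{ij}` of both linear programs. -/
def objective (x : T → T → ℝ) : ℝ := ∑ i, ∑ j, I.reward i j * x i j

/-- Feasibility for the linear program `LP^OFF`. -/
structure FeasibleOff (x : T → T → ℝ) : Prop where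
  nonneg : ∀ i j, 0 ≤ x i j
  match_rate : ∀ (j : T) (S S' : Finset T),
    ∑ i ∈ S, x i j + ∑ i ∈ S', x j i ≤
      I.arrivalRate j *
        (1 - I.abandonRate j / (I.abandonRate j + ∑ i ∈ S', I.arrivalRate i) *
          Real.exp (-∑ i ∈ S, I.arrivalRate i / I.abandonRate i))

/-- Feasibility for the linear program `LP^OFF-relaxed`. -/
structure FeasibleRelaxed (x : T → T → ℝ) : Prop where
  nonneg : ∀ i j, 0 ≤ x i j
  balance : ∀ j : T, ∑ i, x i j + ∑ i, x j i ≤ I.arrivalRate j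
  match_rate : ∀ (j : T) (S : Finset T),
    ∑ i ∈ S, x i j ≤
      I.arrivalRate j * (1 - Real.exp (-∑ i ∈ S, I.arrivalRate i / I.abandonRate i))

/-- Objective values of the feasible solutions of `LP^OFF`. -/
def lpOffValues : Set ℝ := objective I '' {x | FeasibleOff I x}

/-- Objective values of the feasible solutions of `LP^OFF-relaxed`. -/
def lpRelaxedValues : Set ℝ := objective I '' {x | FeasibleRelaxed I x}

/-- The optimal value of `LP^OFF`. -/
noncomputable def lpOff : ℝ := sSup (lpOffValues I)

/-- The optimal value of `LP^OFF-relaxed`. -/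
noncomputable def lpRelaxed : ℝ := sSup (lpRelaxedValues I)

end LinearPrograms

end DynMatch

/-! Both inequalities come from a counting argument at a fixed horizon `t`. Take a reward-maximal
matching of the agents who arrive before `t`, and let `x i j` be the expected number of its pairs
with an earlier agent of type `i` and a later one of type `j`, divided by `t`. The objective at `x`
is then exactly the optimal value at horizon `t`, and `x` turns out to be feasible for `LP^OFF`
(`exists_feasibleOff`).

For feasibility, fix `j`, `S`, `S'`. A type-`j` agent contributing to the left side either found a
partner with type in `S` present at arrival or saw one with type in `S'` arrive during the sojourn,
so the agent is not `Lonely` (`Valid.sum_pairCount_le`). Lonely agents are frequent enough: a type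
`i` started empty forms an infinite-server queue, whose probability of being empty at time `v` is
`exp (-(λ/μ) (1 - exp (-μ v)))`, at least its stationary value `exp (-λ/μ)`. An `Exp (μ_j)` sojourn
contains no arrival of a type in `S'` with probability `μ_j / (μ_j + ∑ λ_i)`. Multiplying over the
independent streams and integrating over the arrivals of type `j` bounds the expected number of
lonely agents from below (`tsum_marketLaw_lonely_ge`); subtraction from `λ_j t` gives the constraint
(`lintegral_metCount_le`). The bounds are non-asymptotic, so no stationary regime is needed. The
relaxed program keeps only the consequences of `S = S' = T` and of `S' = ∅` (`FeasibleOff.relaxed`).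

The limit exists by Fekete's lemma. A Poisson stream restarted at time `s` has its original law
(`measurePreserving_restart`), so optimal matchings of two successive periods combine and the mean
optimal reward is superadditive; it is also monotone and at most linear. The maximum over policies
is attained because almost every history is finite and has finitely many matchings. Both linear
programs have compact, nonempty feasible sets.

Everything is computed on the canonical space of interarrival and sojourn times, where the law is a
product (`IsMarketProcess.hasLaw`). -/

namespace DynMatch

open scoped ENNReal

/-! ### I.i.d. sequences of marks and the decomposition at the first mark -/

section Stream

/-- The joint law of an interarrival time and a sojourn time of type `i`. -/
noncomputable def markLaw {T : Type*} (I : Instance T) (i : T) : Measure (ℝ × ℝ) :=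
  (expMeasure (I.arrivalRate i)).prod (expMeasure (I.abandonRate i))

instance isProbabilityMeasure_markLaw {T : Type*} (I : Instance T) (i : T) :
    IsProbabilityMeasure (markLaw I i) := by
  have := isProbabilityMeasure_expMeasure (I.arrivalRate_pos i)
  have := isProbabilityMeasure_expMeasure (I.abandonRate_pos i)
  unfold markLaw
  infer_instance

/-- The law of the sequence of (interarrival time, sojourn time) of the agents of type `i`. -/
noncomputable def streamLaw {T : Type*} (I : Instance T) (i : T) : Measure (ℕ → ℝ × ℝ) :=
  Measure.infinitePi fun _ => markLaw I i

instance isProbabilityMeasure_streamLaw {T : Type*} (I : Instance T) (i : T) :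
    IsProbabilityMeasure (streamLaw I i) := by
  unfold streamLaw
  infer_instance

/-- Prepend an element to a sequence. -/
def cons {α : Type*} (x : α) (z : ℕ → α) : ℕ → α
  | 0 => x
  | n + 1 => z n

@[simp] lemma cons_zero {α : Type*} (x : α) (z : ℕ → α) : cons x z 0 = x := rfl

@[simp] lemma cons_succ {α : Type*} (x : α) (z : ℕ → α) (n : ℕ) : cons x z (n + 1) = z n := rfl

@[fun_prop]
lemma measurable_cons {α : Type*} [MeasurableSpace α] :
    Measurable fun p : α × (ℕ → α) => cons p.1 p.2 := by
  refine measurable_pi_lambda _ fun n => ?_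
  cases n with
  | zero => exact measurable_fst
  | succ n => exact (measurable_pi_apply n).comp measurable_snd

/-- A product measure is determined by its finite cylinders, and `cons` pulls a cylinder back to a
rectangle. This permits conditioning on the first arrival, the basis of the inductions on streams
below. -/
lemma measurePreserving_cons {α : Type*} [MeasurableSpace α] (ν : Measure α)
    [IsProbabilityMeasure ν] :
    MeasurePreserving (fun p : α × (ℕ → α) => cons p.1 p.2)
      (ν.prod (Measure.infinitePi fun _ : ℕ => ν)) (Measure.infinitePi fun _ : ℕ => ν) := by
  refine ⟨measurable_cons, ?_⟩
  refine Measure.eq_infinitePi _ fun s t ht => ?_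
  classical
  -- Padding with `univ` turns the cylinder into one over an initial segment of `ℕ`, from which the
  -- coordinate `0` can be split off.
  set t' : ℕ → Set α := fun i => if i ∈ s then t i else Set.univ with ht'
  have ht'm : ∀ i, MeasurableSet (t' i) := fun i => by
    by_cases h : i ∈ s <;> simp [ht', h, ht]
  have hsub : s ⊆ Finset.range (s.sup id + 1) := fun i hi => by
    simpa [Nat.lt_succ_iff] using Finset.le_sup (f := id) hi
  have h1 : (s : Set ℕ).pi t = ((Finset.range (s.sup id + 1) : Finset ℕ) : Set ℕ).pi t' := by
    ext z
    constructor
    · intro h i _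
      by_cases hi : i ∈ s
      · simpa [ht', hi] using h i hi
      · simp [ht', hi]
    · intro h i hi
      have hi' : i ∈ s := hi
      simpa [ht', hi'] using h i (hsub hi)
  have h2 : ∏ i ∈ s, ν (t i) = ∏ i ∈ Finset.range (s.sup id + 1), ν (t' i) := by
    rw [← Finset.prod_subset hsub (f := fun i => ν (t' i))]
    · exact Finset.prod_congr rfl fun i hi => by simp [ht', hi]
    · intro i _ hi
      simp [ht', hi]
  rw [h1, h2, Measure.map_apply measurable_cons
    (MeasurableSet.pi (Set.to_countable _) fun i _ => ht'm i)]
  have h3 : (fun p : α × (ℕ → α) => cons p.1 p.2) ⁻¹'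
      (((Finset.range (s.sup id + 1) : Finset ℕ) : Set ℕ).pi t') =
      t' 0 ×ˢ ((Finset.range (s.sup id) : Finset ℕ) : Set ℕ).pi fun i => t' (i + 1) := by
    ext ⟨x, z⟩
    simp only [Set.mem_preimage, Set.mem_pi, Finset.coe_range, Set.mem_Iio, Set.mem_prod]
    constructor
    · intro h
      exact ⟨h 0 (by omega), fun i hi => h (i + 1) (by omega)⟩
    · rintro ⟨h0, h⟩ i hi
      cases i with
      | zero => exact h0
      | succ i => exact h i (by omega)
  rw [h3, Measure.prod_prod, Measure.infinitePi_pi _ (fun i _ => ht'm _),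
    Finset.prod_range_succ' _ (s.sup id), mul_comm]

variable {T : Type*} (I : Instance T) (i : T)

lemma lintegral_streamLaw {F : (ℕ → ℝ × ℝ) → ℝ≥0∞} (hF : Measurable F) :
    ∫⁻ z, F z ∂streamLaw I i =
      ∫⁻ x, ∫⁻ z, F (cons x z) ∂streamLaw I i ∂markLaw I i := by
  unfold streamLaw
  rw [← (measurePreserving_cons (markLaw I i)).lintegral_comp hF,
    lintegral_prod (fun p : (ℝ × ℝ) × (ℕ → ℝ × ℝ) => F (cons p.1 p.2))
      (hF.comp measurable_cons).aemeasurable]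

lemma streamLaw_apply {A : Set (ℕ → ℝ × ℝ)} (hA : MeasurableSet A) :
    streamLaw I i A = ∫⁻ x, streamLaw I i {z | cons x z ∈ A} ∂markLaw I i := by
  unfold streamLaw
  rw [← (measurePreserving_cons (markLaw I i)).measure_preimage hA.nullMeasurableSet,
    Measure.prod_apply (measurable_cons hA)]
  rfl

lemma lintegral_markLaw {F : ℝ × ℝ → ℝ≥0∞} (hF : Measurable F) :
    ∫⁻ x, F x ∂markLaw I i = ∫⁻ u, ∫⁻ s, F (u, s) ∂expMeasure (I.abandonRate i)
      ∂expMeasure (I.arrivalRate i) := by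
  have := isProbabilityMeasure_expMeasure (I.arrivalRate_pos i)
  have := isProbabilityMeasure_expMeasure (I.abandonRate_pos i)
  unfold markLaw
  rw [lintegral_prod _ hF.aemeasurable]

end Stream

/-! ### Exponential distributions -/

section Exponential

variable {l : ℝ}

lemma lintegral_expMeasure (l : ℝ) {f : ℝ → ℝ≥0∞} (hf : Measurable f) :
    ∫⁻ u, f u ∂expMeasure l =
      ∫⁻ u in Set.Ioi 0, ENNReal.ofReal (l * Real.exp (-(l * u))) * f u := by
  have h0 : expMeasure l = volume.withDensity (exponentialPDF l) := rfl
  have hm : Measurable (exponentialPDF l) := (measurable_exponentialPDFReal l).ennreal_ofReal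
  rw [h0, lintegral_withDensity_eq_lintegral_mul _ hm hf, ← lintegral_indicator measurableSet_Ioi]
  refine lintegral_congr_ae ?_
  filter_upwards [Measure.ae_ne volume (0 : ℝ)] with u hu
  rcases lt_or_gt_of_ne hu with h | h
  · simp [exponentialPDF_of_neg h, h.le]
  · simp [exponentialPDF_of_nonneg h.le, h]

lemma expMeasure_Iic (hl : 0 < l) {x : ℝ} (hx : 0 ≤ x) :
    expMeasure l (Set.Iic x) = ENNReal.ofReal (1 - Real.exp (-(l * x))) := by
  have := isProbabilityMeasure_expMeasure hl
  rw [← ofReal_measureReal, ← cdf_eq_real, cdf_expMeasure_eq hl, if_pos hx]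

instance : NullSingletonClass (expMeasure l) := by
  have h0 : expMeasure l = volume.withDensity (exponentialPDF l) := rfl
  rw [h0]
  infer_instance

lemma expMeasure_Iio (hl : 0 < l) {x : ℝ} (hx : 0 ≤ x) :
    expMeasure l (Set.Iio x) = ENNReal.ofReal (1 - Real.exp (-(l * x))) := by
  rw [← expMeasure_Iic hl hx]
  exact measure_congr Iio_ae_eq_Iic

lemma expMeasure_Ioi (hl : 0 < l) {x : ℝ} (hx : 0 ≤ x) :
    expMeasure l (Set.Ioi x) = ENNReal.ofReal (Real.exp (-(l * x))) := by
  have := isProbabilityMeasure_expMeasure hl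
  rw [← Set.compl_Iic, prob_compl_eq_one_sub measurableSet_Iic, expMeasure_Iic hl hx,
    ← ENNReal.ofReal_one, ← ENNReal.ofReal_sub _ (by simp; positivity)]
  simp

lemma ae_pos_expMeasure (hl : 0 < l) : ∀ᵐ x ∂expMeasure l, 0 < x := by
  have := isProbabilityMeasure_expMeasure hl
  have h := expMeasure_Ioi hl le_rfl
  simp only [mul_zero, neg_zero, Real.exp_zero, ENNReal.ofReal_one] at h
  exact (prob_compl_eq_zero_iff measurableSet_Ioi).2 h

end Exponential

end DynMatch

namespace DynMatch

open scoped ENNReal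

/-! ### Thinned Poisson intensities -/

section Intensity

open Classical in
/-- The probability that an exponential clock of rate `m` rings before time `v`, or `1` if the
clock is disregarded (`¬ D`). -/
noncomputable def thinProb (D : Prop) (m v : ℝ) : ℝ :=
  if D then 1 - Real.exp (-(m * v)) else 1

open Classical in
/-- The mean number, over `[0, v]`, of arrivals of rate `l` thinned by `thinProb`. -/
noncomputable def thinMean (D : Prop) (l m v : ℝ) : ℝ :=
  l * v - if D then l / m * (1 - Real.exp (-(m * v))) else 0

variable {D : Prop} {l m : ℝ}

lemma thinProb_nonneg (hm : 0 < m) {v : ℝ} (hv : 0 ≤ v) : 0 ≤ thinProb D m v := by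
  unfold thinProb
  split_ifs
  · simp only [sub_nonneg, Real.exp_le_one_iff]
    nlinarith
  · exact zero_le_one

lemma continuous_thinProb : Continuous (thinProb D m) := by
  unfold thinProb
  split_ifs <;> fun_prop

lemma continuous_thinMean : Continuous (thinMean D l m) := by
  unfold thinMean
  split_ifs <;> fun_prop

@[simp] lemma thinMean_zero : thinMean D l m 0 = 0 := by
  simp [thinMean]

lemma hasDerivAt_thinMean (hm : 0 < m) (v : ℝ) :
    HasDerivAt (thinMean D l m) (l * thinProb D m v) v := by
  unfold thinMean thinProb
  have h1 : HasDerivAt (fun v : ℝ => l * v) l v := by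
    simpa using (hasDerivAt_id v).const_mul l
  split_ifs
  · have h2 : HasDerivAt (fun v : ℝ => Real.exp (-(m * v))) (Real.exp (-(m * v)) * (-(m * 1))) v :=
      ((hasDerivAt_id v).const_mul m).neg.exp
    have h3 := h1.sub ((h2.const_sub 1).const_mul (l / m))
    convert! h3 using 1
    field_simp
  · simpa using h1

lemma thinMean_nonneg (hl : 0 < l) (hm : 0 < m) {v : ℝ} (hv : 0 ≤ v) : 0 ≤ thinMean D l m v := by
  have hmono : MonotoneOn (thinMean D l m) (Set.Ici 0) := by
    refine monotoneOn_of_deriv_nonneg (convex_Ici 0) continuous_thinMean.continuousOn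
      (fun x _ => (hasDerivAt_thinMean hm x).differentiableAt.differentiableWithinAt)
      fun x hx => ?_
    rw [(hasDerivAt_thinMean hm x).deriv]
    rw [interior_Ici] at hx
    exact mul_nonneg hl.le (thinProb_nonneg hm (le_of_lt hx))
  simpa using hmono Set.self_mem_Ici hv hv

-- Dropping the nonnegative term with `exp (-(m * v))` replaces the empty-queue probability at time
-- `v` by its stationary value. This is the only loss in the estimate of the number of lonely
-- agents.
open Classical in
lemma thinMean_ge (hl : 0 < l) (hm : 0 < m) (v : ℝ) :
    -(if D then l / m else 0) + l * v ≤ thinMean D l m v := by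
  unfold thinMean
  split_ifs
  · have : 0 ≤ l / m * Real.exp (-(m * v)) := by positivity
    linarith
  · simp

/-- The integrand is the derivative of `thinMean ^ (n + 1) / (n + 1)!`, by `hasDerivAt_thinMean`.
Each further thinned arrival thus raises the power by one, which produces Poisson weights. -/
lemma lintegral_thinMean_pow (hl : 0 < l) (hm : 0 < m) {t : ℝ} (ht : 0 ≤ t) (n : ℕ) :
    ∫⁻ v in Set.Ioo 0 t,
        ENNReal.ofReal (l * thinProb D m v * (thinMean D l m v ^ n / n.factorial)) =
      ENNReal.ofReal (thinMean D l m t ^ (n + 1) / (n + 1).factorial) := by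
  have hc : Continuous fun v => l * thinProb D m v * (thinMean D l m v ^ n / n.factorial) := by
    have := continuous_thinProb (D := D) (m := m)
    have := continuous_thinMean (D := D) (l := l) (m := m)
    fun_prop
  rw [setLIntegral_congr Ioo_ae_eq_Ioc, ← ofReal_integral_eq_lintegral_ofReal]
  · congr 1
    rw [← intervalIntegral.integral_of_le ht,
      intervalIntegral.integral_eq_sub_of_hasDerivAt
        (f := fun v => thinMean D l m v ^ (n + 1) / (n + 1).factorial)]
    · simp
    · intro v _
      have h := ((hasDerivAt_thinMean (D := D) (l := l) hm v).pow (n + 1)).div_const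
        ((n + 1).factorial : ℝ)
      convert! h using 1
      rw [Nat.factorial_succ]
      push_cast
      have : (n.factorial : ℝ) ≠ 0 := by positivity
      field_simp
    · exact hc.intervalIntegrable _ _
  · exact (hc.integrableOn_Icc (a := 0) (b := t)).mono_set Set.Ioc_subset_Icc_self
  · refine (ae_restrict_iff' measurableSet_Ioc).2 (ae_of_all _ fun v hv => ?_)
    have h1 := thinProb_nonneg (D := D) hm hv.1.le
    have h2 := thinMean_nonneg (D := D) hl hm hv.1.le
    positivity

lemma tsum_thinMean (hl : 0 < l) (hm : 0 < m) {v : ℝ} (hv : 0 ≤ v) :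
    ∑' n : ℕ, ENNReal.ofReal (thinMean D l m v ^ n / n.factorial) =
      ENNReal.ofReal (Real.exp (thinMean D l m v)) := by
  have h2 := thinMean_nonneg (D := D) hl hm hv
  rw [Real.exp_eq_exp_ℝ, NormedSpace.exp_eq_tsum_div,
    ENNReal.ofReal_tsum_of_nonneg (fun n => by positivity)
      (Real.summable_pow_div_factorial _)]

lemma expMeasure_thin (hm : 0 < m) {v : ℝ} (hv : 0 ≤ v) :
    expMeasure m {s | D → s < v} = ENNReal.ofReal (thinProb D m v) := by
  have := isProbabilityMeasure_expMeasure hm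
  unfold thinProb
  split_ifs with h
  · simp only [h, forall_const]
    exact expMeasure_Iio hm hv
  · simp [h]

end Intensity

/-! ### Empty-system probabilities and the law of the arrival times -/

section Stream

/-- The arrival times of a sequence of (interarrival time, sojourn time). -/
def arrTime (z : ℕ → ℝ × ℝ) (k : ℕ) : ℝ := ∑ n ∈ Finset.range (k + 1), (z n).1

/-- The departure times of a sequence of (interarrival time, sojourn time). -/
def depTime (z : ℕ → ℝ × ℝ) (k : ℕ) : ℝ := arrTime z k + (z k).2

lemma arrTime_succ (z : ℕ → ℝ × ℝ) (k : ℕ) : arrTime z (k + 1) = arrTime z k + (z (k + 1)).1 :=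
  Finset.sum_range_succ _ _

@[simp] lemma arrTime_cons_zero (x : ℝ × ℝ) (z : ℕ → ℝ × ℝ) : arrTime (cons x z) 0 = x.1 := by
  simp [arrTime]

@[simp] lemma arrTime_cons_succ (x : ℝ × ℝ) (z : ℕ → ℝ × ℝ) (k : ℕ) :
    arrTime (cons x z) (k + 1) = x.1 + arrTime z k := by
  unfold arrTime
  rw [Finset.sum_range_succ']
  simp [add_comm]

@[simp] lemma depTime_cons_zero (x : ℝ × ℝ) (z : ℕ → ℝ × ℝ) :
    depTime (cons x z) 0 = x.1 + x.2 := by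
  simp [depTime]

@[simp] lemma depTime_cons_succ (x : ℝ × ℝ) (z : ℕ → ℝ × ℝ) (k : ℕ) :
    depTime (cons x z) (k + 1) = x.1 + depTime z k := by
  simp [depTime, add_assoc]

@[fun_prop]
lemma measurable_arrTime (k : ℕ) : Measurable fun z : ℕ → ℝ × ℝ => arrTime z k := by
  unfold arrTime
  fun_prop

@[fun_prop]
lemma measurable_depTime (k : ℕ) : Measurable fun z : ℕ → ℝ × ℝ => depTime z k := by
  unfold depTime
  fun_prop

variable {T : Type*} (I : Instance T) (i : T)

lemma ae_pos_streamLaw : ∀ᵐ z ∂streamLaw I i, ∀ k, 0 < (z k).1 ∧ 0 < (z k).2 := by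
  have := isProbabilityMeasure_expMeasure (I.arrivalRate_pos i)
  have := isProbabilityMeasure_expMeasure (I.abandonRate_pos i)
  refine ae_all_iff.2 fun k => ?_
  have h : ∀ᵐ x ∂markLaw I i, 0 < x.1 ∧ 0 < x.2 := by
    refine Filter.Eventually.and ?_ ?_
    · exact Measure.quasiMeasurePreserving_fst.ae (ae_pos_expMeasure (I.arrivalRate_pos i))
    · exact Measure.quasiMeasurePreserving_snd.ae (ae_pos_expMeasure (I.abandonRate_pos i))
  exact (measurePreserving_eval_infinitePi (fun _ : ℕ => markLaw I i) k).quasiMeasurePreserving.ae h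

lemma arrTime_pos {z : ℕ → ℝ × ℝ} (hz : ∀ k, 0 < (z k).1) (k : ℕ) : 0 < arrTime z k :=
  Finset.sum_pos (fun n _ => hz n) ⟨0, by simp⟩

lemma strictMono_arrTime {z : ℕ → ℝ × ℝ} (hz : ∀ k, 0 < (z k).1) : StrictMono (arrTime z) :=
  strictMono_nat_of_lt_succ fun k => by
    rw [arrTime_succ]
    linarith [hz (k + 1)]

lemma lintegral_markLaw_thin {D : Prop} {g : ℝ → ℝ≥0∞} {b : ℝ → ℝ} (hg : Measurable g)
    (hb : Measurable b) :
    ∫⁻ x, g x.1 * {p : ℝ × ℝ | D → p.2 < b p.1}.indicator 1 x ∂markLaw I i =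
      ∫⁻ u in Set.Ioi 0, ENNReal.ofReal (I.arrivalRate i * Real.exp (-(I.arrivalRate i * u))) *
        (g u * expMeasure (I.abandonRate i) {s | D → s < b u}) := by
  have := isProbabilityMeasure_expMeasure (I.abandonRate_pos i)
  have hmeas : MeasurableSet {p : ℝ × ℝ | D → p.2 < b p.1} :=
    measurableSet_setOfPred.2 (Measurable.imp measurable_const
      (measurableSet_setOfPred.1 (measurableSet_lt (by fun_prop) (by fun_prop))))
  have h1 : Measurable ({p : ℝ × ℝ | D → p.2 < b p.1}.indicator (1 : ℝ × ℝ → ℝ≥0∞)) :=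
    measurable_one.indicator hmeas
  have h2 : Measurable fun u : ℝ => expMeasure (I.abandonRate i) {s | D → s < b u} :=
    measurable_measure_prodMk_left hmeas
  rw [lintegral_markLaw _ _ (by fun_prop), ← lintegral_expMeasure _ (by fun_prop)]
  refine lintegral_congr fun u => ?_
  simp only
  have h3 : MeasurableSet {s | D → s < b u} := measurable_prodMk_left hmeas
  rw [lintegral_const_mul _ (by fun_prop), ← lintegral_indicator_one h3]
  rfl

/-- Exactly `n` agents arrive before time `t`, the next one only after time `t + c`, and, if `D`,
the former are all gone by time `t`. -/
def voidEvent (D : Prop) (t c : ℝ) (n : ℕ) : Set (ℕ → ℝ × ℝ) :=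
  {z | (∀ k < n, arrTime z k < t ∧ (D → depTime z k < t)) ∧ t + c < arrTime z n}

lemma measurableSet_voidEvent (D : Prop) (t c : ℝ) (n : ℕ) :
    MeasurableSet (voidEvent D t c n) := by
  unfold voidEvent
  refine measurableSet_setOfPred.2 ?_
  refine Measurable.and ?_ ?_
  · refine Measurable.forall fun k => Measurable.imp measurable_const
      (Measurable.and ?_ (Measurable.imp measurable_const ?_))
    · exact measurableSet_setOfPred.1 (measurableSet_lt (by fun_prop) (by fun_prop))
    · exact measurableSet_setOfPred.1 (measurableSet_lt (by fun_prop) (by fun_prop))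
  · exact measurableSet_setOfPred.1 (measurableSet_lt (by fun_prop) (by fun_prop))

/-- Induction on `n`, conditioning on the first arrival at `u`. That agent is gone by `t` with
probability `thinProb D μ (t - u)`, and the remaining stream faces the same event with horizon `t -
u` and one arrival fewer. The result is a Poisson weight for departed arrivals times the probability
of no other arrival up to `t + c`. -/
lemma streamLaw_voidEvent (D : Prop) {c : ℝ} (hc : 0 ≤ c) (n : ℕ) {t : ℝ} (ht : 0 ≤ t) :
    streamLaw I i (voidEvent D t c n) =
      ENNReal.ofReal (Real.exp (-(I.arrivalRate i * (t + c)))) *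
        ENNReal.ofReal (thinMean D (I.arrivalRate i) (I.abandonRate i) t ^ n / n.factorial) := by
  have hl := I.arrivalRate_pos i
  have hm := I.abandonRate_pos i
  have := isProbabilityMeasure_expMeasure hl
  have := isProbabilityMeasure_expMeasure hm
  induction n generalizing t with
  | zero =>
    rw [streamLaw_apply _ _ (measurableSet_voidEvent D t c 0)]
    simp only [voidEvent, Set.mem_ofPred_eq, not_lt_zero, IsEmpty.forall_iff, implies_true,
      true_and, arrTime_cons_zero, pow_zero, Nat.factorial_zero, Nat.cast_one, div_one,
      ENNReal.ofReal_one, mul_one]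
    have h1 : ∀ x : ℝ × ℝ, streamLaw I i {z | t + c < x.1} =
        (Set.Ioi (t + c)).indicator 1 x.1 := fun x => by
      by_cases h : t + c < x.1 <;> simp [h]
    simp_rw [h1]
    have h2 : Measurable ((Set.Ioi (t + c)).indicator (1 : ℝ → ℝ≥0∞)) :=
      measurable_one.indicator measurableSet_Ioi
    rw [lintegral_markLaw _ _ (F := fun x => (Set.Ioi (t + c)).indicator 1 x.1)
      (h2.comp measurable_fst)]
    simp only [lintegral_const, measure_univ, mul_one]
    rw [lintegral_indicator_one measurableSet_Ioi, expMeasure_Ioi hl (by positivity)]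
  | succ n ih =>
    rw [streamLaw_apply _ _ (measurableSet_voidEvent D t c (n + 1))]
    set C := ENNReal.ofReal (Real.exp (-(I.arrivalRate i * (t + c))))
    -- `g u` is the value given by the induction hypothesis for the stream after a first arrival at
    -- `u`.
    obtain ⟨g, hg⟩ : ∃ g : ℝ → ℝ≥0∞, g = fun u =>
      ENNReal.ofReal (Real.exp (-(I.arrivalRate i * (t - u + c)))) * ENNReal.ofReal
        (thinMean D (I.arrivalRate i) (I.abandonRate i) (t - u) ^ n / n.factorial) := ⟨_, rfl⟩
    have hgm : Measurable ((Set.Iio t).indicator g) := by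
      have hcm := continuous_thinMean (D := D) (l := I.arrivalRate i) (m := I.abandonRate i)
      refine Measurable.indicator ?_ measurableSet_Iio
      rw [hg]
      have hcm' := hcm.measurable
      fun_prop
    have h1 : ∀ x : ℝ × ℝ, streamLaw I i {z | cons x z ∈ voidEvent D t c (n + 1)} =
        (Set.Iio t).indicator g x.1 * {p : ℝ × ℝ | D → p.2 < t - p.1}.indicator 1 x := by
      intro x
      have h2 : {z | cons x z ∈ voidEvent D t c (n + 1)} =
          {z | x.1 < t ∧ (D → x.2 < t - x.1) ∧ z ∈ voidEvent D (t - x.1) c n} := by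
        ext z
        simp only [voidEvent, Set.mem_ofPred_eq, arrTime_cons_succ]
        constructor
        · rintro ⟨ha, hb⟩
          have h0 := ha 0 (by omega)
          simp only [arrTime_cons_zero, depTime_cons_zero] at h0
          refine ⟨h0.1, fun hD => by linarith [h0.2 hD], fun k hk => ?_, by linarith⟩
          have hk' := ha (k + 1) (by omega)
          simp only [arrTime_cons_succ, depTime_cons_succ] at hk'
          exact ⟨by linarith [hk'.1], fun hD => by linarith [hk'.2 hD]⟩
        · rintro ⟨h0, h0', ha, hb⟩
          refine ⟨fun k hk => ?_, by linarith⟩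
          cases k with
          | zero =>
            simp only [arrTime_cons_zero, depTime_cons_zero]
            exact ⟨h0, fun hD => by linarith [h0' hD]⟩
          | succ k =>
            simp only [arrTime_cons_succ, depTime_cons_succ]
            have hk' := ha k (by omega)
            exact ⟨by linarith [hk'.1], fun hD => by linarith [hk'.2 hD]⟩
      rw [h2]
      by_cases h3 : x.1 < t
      · by_cases h4 : D → x.2 < t - x.1
        · have h5 : x ∈ {p : ℝ × ℝ | D → p.2 < t - p.1} := h4
          rw [Set.indicator_of_mem h5, Set.indicator_of_mem (show x.1 ∈ Set.Iio t from h3),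
            Pi.one_apply, mul_one, hg]
          refine Eq.trans ?_ (ih (sub_nonneg.2 h3.le))
          congr 1
          ext z
          exact ⟨fun h => h.2.2, fun h => ⟨h3, h4, h⟩⟩
        · have h5 : x ∉ {p : ℝ × ℝ | D → p.2 < t - p.1} := h4
          rw [Set.indicator_of_notMem h5]
          simp [h4]
      · rw [Set.indicator_of_notMem (show x.1 ∉ Set.Iio t from h3)]
        simp [h3]
    simp_rw [h1]
    rw [lintegral_markLaw_thin I i hgm (b := fun u => t - u) (by fun_prop),
      ← lintegral_thinMean_pow hl hm ht, ← lintegral_const_mul' _ _ ENNReal.ofReal_ne_top]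
    rw [← lintegral_indicator measurableSet_Ioo, ← lintegral_indicator measurableSet_Ioi]
    -- The reflection `u ↦ t - u` replaces the first arrival time by the time that remains until
    -- `t`, the variable of `lintegral_thinMean_pow`.
    refine Eq.trans (lintegral_congr fun u => ?_) (lintegral_sub_left_eq_self _ t)
    by_cases hu : u ∈ Set.Ioo 0 t
    · rw [Set.indicator_of_mem (show t - u ∈ Set.Ioo 0 t from
          ⟨by linarith [hu.2], by linarith [hu.1]⟩),
        Set.indicator_of_mem (show u ∈ Set.Ioi 0 from hu.1),
        Set.indicator_of_mem (show u ∈ Set.Iio t from hu.2),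
        expMeasure_thin hm (by linarith [hu.2]), hg]
      have hp := thinProb_nonneg (D := D) hm (v := t - u) (by linarith [hu.2])
      have hM := thinMean_nonneg (D := D) hl hm (v := t - u) (by linarith [hu.2])
      simp only
      rw [← ENNReal.ofReal_mul (by positivity), ← ENNReal.ofReal_mul (by positivity),
        ← ENNReal.ofReal_mul (by positivity), ← ENNReal.ofReal_mul (by positivity)]
      congr 1
      have : Real.exp (-(I.arrivalRate i * (t + c))) = Real.exp (-(I.arrivalRate i * u)) *
          Real.exp (-(I.arrivalRate i * (t - u + c))) := by
        rw [← Real.exp_add]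
        congr 1
        ring
      rw [this]
      ring
    · rw [Set.indicator_of_notMem (show t - u ∉ Set.Ioo 0 t from
          fun h => hu ⟨by linarith [h.2], by linarith [h.1]⟩)]
      by_cases h0 : 0 < u
      · have h3 : ¬ u < t := fun h => hu ⟨h0, h⟩
        simp [h3]
      · simp [h0]

/-- The indicator that, if `D`, all agents before the `k`-th are gone when the latter arrives. -/
noncomputable def goneBefore (D : Prop) (k : ℕ) : (ℕ → ℝ × ℝ) → ℝ≥0∞ :=
  {z | D → ∀ n < k, depTime z n < arrTime z k}.indicator 1

@[fun_prop]
lemma measurable_goneBefore (D : Prop) (k : ℕ) : Measurable (goneBefore D k) := by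
  refine measurable_one.indicator (measurableSet_setOfPred.2 ?_)
  refine Measurable.imp measurable_const (Measurable.forall fun n => Measurable.imp
    measurable_const ?_)
  exact measurableSet_setOfPred.1 (measurableSet_lt (by fun_prop) (by fun_prop))

/-- The first interarrival time shifts all times alike and cancels, so the condition on the first
agent only compares the sojourn time with the time elapsed since that arrival. -/
lemma goneBefore_cons_succ (D : Prop) (k : ℕ) (x : ℝ × ℝ) (z : ℕ → ℝ × ℝ) :
    goneBefore D (k + 1) (cons x z) =
      {p : ℝ × ℝ | D → p.2 < arrTime z k}.indicator 1 x * goneBefore D k z := by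
  unfold goneBefore
  have h : (cons x z ∈ {z | D → ∀ n < k + 1, depTime z n < arrTime z (k + 1)}) ↔
      x ∈ {p : ℝ × ℝ | D → p.2 < arrTime z k} ∧
        z ∈ {z | D → ∀ n < k, depTime z n < arrTime z k} := by
    simp only [Set.mem_ofPred_eq, arrTime_cons_succ]
    constructor
    · refine fun h => ⟨fun hD => ?_, fun hD n hn => ?_⟩
      · simpa using h hD 0 (by omega)
      · simpa using h hD (n + 1) (by omega)
    · rintro ⟨h0, h⟩ hD n hn
      cases n with
      | zero => simpa using h0 hD
      | succ n => simpa using h hD n (by omega)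
  by_cases h1 : x ∈ {p : ℝ × ℝ | D → p.2 < arrTime z k}
  · by_cases h2 : z ∈ {z | D → ∀ n < k, depTime z n < arrTime z k}
    · rw [Set.indicator_of_mem h1, Set.indicator_of_mem h2, Set.indicator_of_mem (h.2 ⟨h1, h2⟩)]
      simp
    · rw [Set.indicator_of_notMem h2, Set.indicator_of_notMem fun h' => h2 (h.1 h').2]
      simp
  · rw [Set.indicator_of_notMem h1, Set.indicator_of_notMem fun h' => h1 (h.1 h').1]
    simp

/-- The law of the `k`-th arrival time, restricted to the event that, if `D`, all previous agents
are gone by then; the sojourn time of the `k`-th agent and the next interarrival time are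
independent of all this. -/
lemma lintegral_arrTime_goneBefore (D : Prop) (k : ℕ) {f : ℝ → ℝ≥0∞} (hf : Measurable f)
    {φ : ℝ × ℝ → ℝ≥0∞} (hφ : Measurable φ) :
    ∫⁻ z, f (arrTime z k) * φ ((z k).2, (z (k + 1)).1) * goneBefore D k z ∂streamLaw I i =
      (∫⁻ s, ∫⁻ g, φ (s, g) ∂expMeasure (I.arrivalRate i) ∂expMeasure (I.abandonRate i)) *
      ∫⁻ v in Set.Ioi 0, ENNReal.ofReal (I.arrivalRate i * Real.exp (-(I.arrivalRate i * v)) *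
        (thinMean D (I.arrivalRate i) (I.abandonRate i) v ^ k / k.factorial)) * f v := by
  have hl := I.arrivalRate_pos i
  have hm := I.abandonRate_pos i
  have := isProbabilityMeasure_expMeasure hl
  have := isProbabilityMeasure_expMeasure hm
  set c := ∫⁻ s, ∫⁻ g, φ (s, g) ∂expMeasure (I.arrivalRate i) ∂expMeasure (I.abandonRate i)
    with hc
  induction k generalizing f with
  | zero =>
    have h0 : ∀ z : ℕ → ℝ × ℝ, goneBefore D 0 z = 1 := fun z =>
      Set.indicator_of_mem (fun _ n hn => absurd hn (by omega)) _
    simp_rw [h0, mul_one]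
    rw [lintegral_streamLaw _ _ (by fun_prop)]
    simp only [arrTime_cons_zero, cons_zero, cons_succ]
    have h1 : ∀ x : ℝ × ℝ, ∫⁻ z, f x.1 * φ (x.2, (z 0).1) ∂streamLaw I i =
        f x.1 * ∫⁻ g, φ (x.2, g) ∂expMeasure (I.arrivalRate i) := fun x => by
      rw [lintegral_const_mul _ (by fun_prop)]
      congr 1
      have h2 : MeasurePreserving (fun z : ℕ → ℝ × ℝ => (z 0).1) (streamLaw I i)
          (expMeasure (I.arrivalRate i)) :=
        (measurePreserving_fst (μ := expMeasure (I.arrivalRate i))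
          (ν := expMeasure (I.abandonRate i))).comp
          (measurePreserving_eval_infinitePi (fun _ : ℕ => markLaw I i) 0)
      exact h2.lintegral_comp (f := fun g => φ (x.2, g)) (by fun_prop)
    simp_rw [h1]
    have h3 : Measurable fun s => ∫⁻ g, φ (s, g) ∂expMeasure (I.arrivalRate i) :=
      hφ.lintegral_prod_right'
    rw [lintegral_markLaw _ _ (by fun_prop)]
    simp only
    simp_rw [lintegral_const_mul _ h3]
    rw [lintegral_mul_const _ hf, ← hc, lintegral_expMeasure _ hf, mul_comm]
    simp
  | succ k ih =>
    rw [lintegral_streamLaw _ _ (by fun_prop)]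
    simp only [arrTime_cons_succ, cons_succ, goneBefore_cons_succ]
    have hq : Measurable fun v : ℝ => expMeasure (I.abandonRate i) {s | D → s < v} := by
      have : MeasurableSet {p : ℝ × ℝ | D → p.2 < p.1} :=
        measurableSet_setOfPred.2 (Measurable.imp measurable_const
          (measurableSet_setOfPred.1 (measurableSet_lt (by fun_prop) (by fun_prop))))
      exact measurable_measure_prodMk_left this
    have hq' : Measurable fun p : ℝ × ℝ =>
        expMeasure (I.abandonRate i) {s | D → s < p.2} := hq.comp measurable_snd
    have hind : Measurable fun p : (ℝ × ℝ) × (ℕ → ℝ × ℝ) =>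
        {q : ℝ × ℝ | D → q.2 < arrTime p.2 k}.indicator (1 : ℝ × ℝ → ℝ≥0∞) p.1 := by
      have : MeasurableSet {p : (ℝ × ℝ) × (ℕ → ℝ × ℝ) | D → p.1.2 < arrTime p.2 k} :=
        measurableSet_setOfPred.2 (Measurable.imp measurable_const
          (measurableSet_setOfPred.1 (measurableSet_lt (by fun_prop) (by fun_prop))))
      exact measurable_one.indicator this
    have hmeas : Measurable fun p : (ℝ × ℝ) × (ℕ → ℝ × ℝ) =>
        f (p.1.1 + arrTime p.2 k) * φ ((p.2 k).2, (p.2 (k + 1)).1) *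
          ({q : ℝ × ℝ | D → q.2 < arrTime p.2 k}.indicator 1 p.1 * goneBefore D k p.2) := by
      fun_prop
    -- With the first arrival at `u`, integrating out that agent's sojourn time leaves a function of
    -- the later arrival time alone. The induction hypothesis applies to `v ↦ f (u + v) * P(D → s <
    -- v)`, which is why `f` is generalized.
    have h1 : ∀ u : ℝ, ∫⁻ s, ∫⁻ z, f (u + arrTime z k) * φ ((z k).2, (z (k + 1)).1) *
        ({q : ℝ × ℝ | D → q.2 < arrTime z k}.indicator 1 (u, s) * goneBefore D k z)
        ∂streamLaw I i ∂expMeasure (I.abandonRate i) =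
        c * ∫⁻ v in Set.Ioi 0, ENNReal.ofReal (I.arrivalRate i *
          Real.exp (-(I.arrivalRate i * v)) *
          (thinMean D (I.arrivalRate i) (I.abandonRate i) v ^ k / k.factorial)) *
          (f (u + v) * expMeasure (I.abandonRate i) {s | D → s < v}) := by
      intro u
      rw [← ih (f := fun v => f (u + v) * expMeasure (I.abandonRate i) {s | D → s < v})
        (by fun_prop), lintegral_lintegral_swap]
      · refine lintegral_congr fun z => ?_
        have h2 : ∫⁻ s, {q : ℝ × ℝ | D → q.2 < arrTime z k}.indicator (1 : ℝ × ℝ → ℝ≥0∞) (u, s)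
            ∂expMeasure (I.abandonRate i) =
            expMeasure (I.abandonRate i) {s | D → s < arrTime z k} := by
          rw [← lintegral_indicator_one]
          · rfl
          · exact measurableSet_setOfPred.2 (Measurable.imp measurable_const
              (measurableSet_setOfPred.1 (measurableSet_lt (by fun_prop) (by fun_prop))))
        have h3 : Measurable fun s => {q : ℝ × ℝ | D → q.2 < arrTime z k}.indicator
            (1 : ℝ × ℝ → ℝ≥0∞) (u, s) :=
          hind.comp (f := fun s : ℝ => (((u, s), z) : (ℝ × ℝ) × (ℕ → ℝ × ℝ))) (by fun_prop)
        rw [lintegral_const_mul _ (h3.mul_const _), lintegral_mul_const _ h3, h2]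
        ring
      · exact (hmeas.comp (f := fun p : ℝ × (ℕ → ℝ × ℝ) =>
          (((u, p.1), p.2) : (ℝ × ℝ) × (ℕ → ℝ × ℝ))) (by fun_prop)).aemeasurable
    have hmk : Measurable fun v => thinMean D (I.arrivalRate i) (I.abandonRate i) v :=
      continuous_thinMean.measurable
    have hmp : Measurable fun v => thinProb D (I.abandonRate i) v :=
      continuous_thinProb.measurable
    rw [lintegral_markLaw _ _ hmeas.lintegral_prod_right']
    simp only
    simp_rw [h1]
    rw [lintegral_const_mul]
    swap
    · refine Measurable.lintegral_prod_right' (f := fun p : ℝ × ℝ =>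
        ENNReal.ofReal (I.arrivalRate i * Real.exp (-(I.arrivalRate i * p.2)) *
          (thinMean D (I.arrivalRate i) (I.abandonRate i) p.2 ^ k / k.factorial)) *
          (f (p.1 + p.2) * expMeasure (I.abandonRate i) {s | D → s < p.2})) ?_
      fun_prop
    congr 1
    rw [lintegral_expMeasure]
    swap
    · refine Measurable.lintegral_prod_right' (f := fun p : ℝ × ℝ =>
        ENNReal.ofReal (I.arrivalRate i * Real.exp (-(I.arrivalRate i * p.2)) *
          (thinMean D (I.arrivalRate i) (I.abandonRate i) p.2 ^ k / k.factorial)) *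
          (f (p.1 + p.2) * expMeasure (I.abandonRate i) {s | D → s < p.2})) ?_
      fun_prop
    obtain ⟨G, hG⟩ : ∃ G : ℝ → ℝ≥0∞, G = (Set.Ioi 0).indicator fun v => ENNReal.ofReal
      (I.arrivalRate i * thinProb D (I.abandonRate i) v *
        (thinMean D (I.arrivalRate i) (I.abandonRate i) v ^ k / k.factorial)) := ⟨_, rfl⟩
    have hGm : Measurable G := by
      rw [hG]
      exact Measurable.indicator (by fun_prop) measurableSet_Ioi
    -- `F (w, v)` is the integrand in the total time `w = u + v` and the time `v` since the first
    -- arrival. The exponential factors depend on `w` only, and the indicator encodes `u > 0`.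
    obtain ⟨F, hF⟩ : ∃ F : ℝ × ℝ → ℝ≥0∞, F = fun p =>
      (Set.Ioi 0).indicator 1 (p.1 - p.2) * (ENNReal.ofReal (I.arrivalRate i *
        Real.exp (-(I.arrivalRate i * p.1))) * f p.1 * G p.2) := ⟨_, rfl⟩
    have hFm : Measurable F := by
      have h4 : Measurable ((Set.Ioi 0).indicator (1 : ℝ → ℝ≥0∞)) :=
        measurable_one.indicator measurableSet_Ioi
      rw [hF]
      fun_prop
    have hleft : ∫⁻ u in Set.Ioi 0, ENNReal.ofReal (I.arrivalRate i *
          Real.exp (-(I.arrivalRate i * u))) *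
        ∫⁻ v in Set.Ioi 0, ENNReal.ofReal (I.arrivalRate i * Real.exp (-(I.arrivalRate i * v)) *
          (thinMean D (I.arrivalRate i) (I.abandonRate i) v ^ k / k.factorial)) *
          (f (u + v) * expMeasure (I.abandonRate i) {s | D → s < v}) =
        ∫⁻ u, ∫⁻ v, F (u + v, v) := by
      rw [← lintegral_indicator measurableSet_Ioi]
      refine lintegral_congr fun u => ?_
      by_cases hu : u ∈ Set.Ioi 0
      · rw [Set.indicator_of_mem hu, ← lintegral_const_mul' _ _ ENNReal.ofReal_ne_top,
          ← lintegral_indicator measurableSet_Ioi]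
        refine lintegral_congr fun v => ?_
        rw [hF, hG]
        simp only [add_sub_cancel_right]
        rw [Set.indicator_of_mem hu]
        by_cases hv : v ∈ Set.Ioi 0
        · rw [Set.indicator_of_mem hv, Set.indicator_of_mem hv,
            expMeasure_thin hm (le_of_lt hv)]
          have hp := thinProb_nonneg (D := D) hm (le_of_lt hv)
          have hM := thinMean_nonneg (D := D) hl hm (le_of_lt hv)
          have h5 : ENNReal.ofReal (I.arrivalRate i * Real.exp (-(I.arrivalRate i * u))) *
              ENNReal.ofReal (I.arrivalRate i * Real.exp (-(I.arrivalRate i * v)) *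
              (thinMean D (I.arrivalRate i) (I.abandonRate i) v ^ k / k.factorial)) *
              ENNReal.ofReal (thinProb D (I.abandonRate i) v) =
              ENNReal.ofReal (I.arrivalRate i * Real.exp (-(I.arrivalRate i * (u + v)))) *
              ENNReal.ofReal (I.arrivalRate i * thinProb D (I.abandonRate i) v *
              (thinMean D (I.arrivalRate i) (I.abandonRate i) v ^ k / k.factorial)) := by
            rw [← ENNReal.ofReal_mul (by positivity), ← ENNReal.ofReal_mul (by positivity),
              ← ENNReal.ofReal_mul (by positivity)]
            congr 1
            rw [mul_add, neg_add, Real.exp_add]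
            ring
          calc _ = (ENNReal.ofReal (I.arrivalRate i * Real.exp (-(I.arrivalRate i * u))) *
              ENNReal.ofReal (I.arrivalRate i * Real.exp (-(I.arrivalRate i * v)) *
              (thinMean D (I.arrivalRate i) (I.abandonRate i) v ^ k / k.factorial)) *
              ENNReal.ofReal (thinProb D (I.abandonRate i) v)) * f (u + v) := by ring
            _ = _ := by
              rw [h5, Pi.one_apply]
              ring
        · rw [Set.indicator_of_notMem hv, Set.indicator_of_notMem hv]
          simp
      · rw [Set.indicator_of_notMem hu, hF]
        simp [Set.indicator_of_notMem hu]
    rw [hleft, lintegral_lintegral_swap (by fun_prop)]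
    have h6 : ∀ v, ∫⁻ u, F (u + v, v) = ∫⁻ w, F (w, v) := fun v =>
      lintegral_add_right_eq_self (fun w => F (w, v)) v
    simp_rw [h6]
    -- For fixed `w`, the inner integral over `0 < v < w` is now that of `lintegral_thinMean_pow`.
    rw [lintegral_lintegral_swap (by fun_prop), ← lintegral_indicator measurableSet_Ioi]
    refine lintegral_congr fun w => ?_
    have h7 : ∀ v, F (w, v) = ENNReal.ofReal (I.arrivalRate i *
        Real.exp (-(I.arrivalRate i * w))) * f w * (Set.Ioo 0 w).indicator (fun v =>
        ENNReal.ofReal (I.arrivalRate i * thinProb D (I.abandonRate i) v *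
        (thinMean D (I.arrivalRate i) (I.abandonRate i) v ^ k / k.factorial))) v := by
      intro v
      rw [hF, hG]
      simp only
      by_cases hv : v ∈ Set.Ioi 0
      · by_cases hw : v < w
        · rw [Set.indicator_of_mem (show w - v ∈ Set.Ioi 0 from sub_pos.2 hw),
            Set.indicator_of_mem hv, Set.indicator_of_mem (show v ∈ Set.Ioo 0 w from ⟨hv, hw⟩)]
          simp
        · rw [Set.indicator_of_notMem (show w - v ∉ Set.Ioi 0 from fun h => hw (sub_pos.1 h)),
            Set.indicator_of_notMem (show v ∉ Set.Ioo 0 w from fun h => hw h.2)]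
          simp
      · rw [Set.indicator_of_notMem hv,
          Set.indicator_of_notMem (show v ∉ Set.Ioo 0 w from fun h => hv h.1)]
        simp
    simp_rw [h7]
    rw [lintegral_const_mul _ (Measurable.indicator (by fun_prop) measurableSet_Ioo),
      lintegral_indicator measurableSet_Ioo]
    by_cases hw : w ∈ Set.Ioi 0
    · rw [Set.indicator_of_mem hw, lintegral_thinMean_pow hl hm (le_of_lt hw),
        mul_right_comm, ← ENNReal.ofReal_mul (by positivity)]
    · rw [Set.indicator_of_notMem hw, Set.Ioo_eq_empty (show ¬ 0 < w from hw)]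
      simp

end Stream

end DynMatch

namespace DynMatch

open scoped ENNReal

/-! ### Expected counts of arrivals -/

section Counting

variable {T : Type*} (I : Instance T) (i : T)

/-- Summing the Poisson weights over `k` gives the exponential of `thinMean`. The resulting
intensity is `λ` times the probability that the own type is absent at time `v`, or simply `λ` when
`D` fails. -/
lemma tsum_lintegral_arrTime_goneBefore (D : Prop) {f : ℝ → ℝ≥0∞} (hf : Measurable f)
    {φ : ℝ × ℝ → ℝ≥0∞} (hφ : Measurable φ) :
    ∑' k, ∫⁻ z, f (arrTime z k) * φ ((z k).2, (z (k + 1)).1) * goneBefore D k z ∂streamLaw I i =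
      (∫⁻ s, ∫⁻ g, φ (s, g) ∂expMeasure (I.arrivalRate i) ∂expMeasure (I.abandonRate i)) *
      ∫⁻ v in Set.Ioi 0, ENNReal.ofReal (I.arrivalRate i * Real.exp (-(I.arrivalRate i * v) +
        thinMean D (I.arrivalRate i) (I.abandonRate i) v)) * f v := by
  have hl := I.arrivalRate_pos i
  have hm := I.abandonRate_pos i
  have hcm : Measurable (thinMean D (I.arrivalRate i) (I.abandonRate i)) :=
    continuous_thinMean.measurable
  simp_rw [lintegral_arrTime_goneBefore I i D _ hf hφ]
  rw [ENNReal.tsum_mul_left, ← lintegral_tsum (fun k => by fun_prop)]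
  congr 1
  refine setLIntegral_congr_fun measurableSet_Ioi fun v hv => ?_
  have hM := thinMean_nonneg (D := D) hl hm (le_of_lt hv)
  have h1 : ∀ k : ℕ, ENNReal.ofReal (I.arrivalRate i * Real.exp (-(I.arrivalRate i * v)) *
      (thinMean D (I.arrivalRate i) (I.abandonRate i) v ^ k / k.factorial)) =
      ENNReal.ofReal (I.arrivalRate i * Real.exp (-(I.arrivalRate i * v))) *
      ENNReal.ofReal (thinMean D (I.arrivalRate i) (I.abandonRate i) v ^ k / k.factorial) :=
    fun k => ENNReal.ofReal_mul (by positivity)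
  simp_rw [h1]
  rw [ENNReal.tsum_mul_right, ENNReal.tsum_mul_left, tsum_thinMean hl hm (le_of_lt hv),
    ← ENNReal.ofReal_mul (by positivity), Real.exp_add, mul_assoc]

lemma goneBefore_false (k : ℕ) (z : ℕ → ℝ × ℝ) : goneBefore False k z = 1 :=
  Set.indicator_of_mem (fun h => h.elim) _

lemma lintegral_Ioi_indicator_Iio {c : ℝ≥0∞} (t : ℝ) :
    ∫⁻ v in Set.Ioi 0, c * (Set.Iio t).indicator 1 v = c * ENNReal.ofReal t := by
  rw [lintegral_const_mul _ (measurable_one.indicator measurableSet_Iio),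
    lintegral_indicator_one measurableSet_Iio, Measure.restrict_apply measurableSet_Iio,
    Set.inter_comm, Set.Ioi_inter_Iio, Real.volume_Ioo, sub_zero]

/-- The expected number of arrivals of type `i` before time `t`. -/
lemma tsum_streamLaw_arrTime_lt (t : ℝ) :
    ∑' k, streamLaw I i {z | arrTime z k < t} =
      ENNReal.ofReal (I.arrivalRate i) * ENNReal.ofReal t := by
  have := isProbabilityMeasure_expMeasure (I.arrivalRate_pos i)
  have := isProbabilityMeasure_expMeasure (I.abandonRate_pos i)
  have hf : Measurable ((Set.Iio t).indicator (1 : ℝ → ℝ≥0∞)) :=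
    measurable_one.indicator measurableSet_Iio
  have h := tsum_lintegral_arrTime_goneBefore I i False hf
    (φ := fun _ => 1) measurable_const
  simp only [goneBefore_false, mul_one, lintegral_const, measure_univ, thinMean, if_false,
    sub_zero, neg_add_cancel, Real.exp_zero, one_mul] at h
  rw [lintegral_Ioi_indicator_Iio] at h
  rw [← h]
  refine tsum_congr fun k => ?_
  rw [← lintegral_indicator_one (measurableSet_lt (by fun_prop) (by fun_prop))]
  rfl

/-- Borel–Cantelli: the expected number of arrivals before any integer is finite. -/
lemma ae_unbounded_arrTime : ∀ᵐ z ∂streamLaw I i, ∀ t, ∃ k, t ≤ arrTime z k := by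
  have h : ∀ n : ℕ, ∀ᵐ z ∂streamLaw I i, ∃ k, (n : ℝ) ≤ arrTime z k := by
    intro n
    have h1 := ae_eventually_notMem (μ := streamLaw I i)
      (s := fun k => {z | arrTime z k < (n : ℝ)}) (by
        rw [tsum_streamLaw_arrTime_lt]
        exact ENNReal.mul_ne_top ENNReal.ofReal_ne_top ENNReal.ofReal_ne_top)
    filter_upwards [h1] with z hz
    obtain ⟨k, hk⟩ := hz.exists
    exact ⟨k, not_lt.1 hk⟩
  filter_upwards [ae_all_iff.2 h] with z hz t
  obtain ⟨n, hn⟩ := exists_nat_ge t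
  obtain ⟨k, hk⟩ := hz n
  exact ⟨k, hn.trans hk⟩

-- By `thinMean_ge` the intensity of arrivals that find their own type absent is bounded below by a
-- constant. The function `φ` of the agent's sojourn time and the next interarrival time factors out
-- by independence.
open Classical in
lemma tsum_goneBefore_ge (D : Prop) (t : ℝ) {φ : ℝ × ℝ → ℝ≥0∞} (hφ : Measurable φ) :
    (∫⁻ s, ∫⁻ g, φ (s, g) ∂expMeasure (I.arrivalRate i) ∂expMeasure (I.abandonRate i)) *
      (ENNReal.ofReal (I.arrivalRate i *
        Real.exp (-(if D then I.arrivalRate i / I.abandonRate i else 0))) * ENNReal.ofReal t) ≤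
    ∑' k, ∫⁻ z, (Set.Iio t).indicator 1 (arrTime z k) * φ ((z k).2, (z (k + 1)).1) *
      goneBefore D k z ∂streamLaw I i := by
  have hl := I.arrivalRate_pos i
  rw [tsum_lintegral_arrTime_goneBefore I i D (measurable_one.indicator measurableSet_Iio) hφ]
  gcongr
  rw [← lintegral_Ioi_indicator_Iio]
  refine lintegral_mono fun v => ?_
  dsimp only
  gcongr
  have := thinMean_ge (D := D) hl (I.abandonRate_pos i) v
  linarith

lemma disjoint_voidEvent (D : Prop) (t : ℝ) {c : ℝ} (hc : 0 ≤ c) :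
    Pairwise (Function.onFun Disjoint (voidEvent D t c)) := by
  have h : ∀ m n, m < n → Disjoint (voidEvent D t c m) (voidEvent D t c n) := by
    intro m n hmn
    refine Set.disjoint_left.2 fun z hz hz' => ?_
    have h1 := (hz'.1 m hmn).1
    have h2 := hz.2
    linarith
  intro m n hmn
  rcases lt_or_gt_of_ne hmn with h' | h'
  · exact h _ _ h'
  · exact (h _ _ h').symm

-- Summing the void probabilities over the number of earlier arrivals bounds the probability that,
-- if `D`, nobody is present at time `t`, and that nobody arrives during the following time `c`.
open Classical in
lemma streamLaw_iUnion_voidEvent_ge (D : Prop) {t c : ℝ} (ht : 0 ≤ t) (hc : 0 ≤ c) :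
    ENNReal.ofReal (Real.exp (-(I.arrivalRate i * c)) *
      Real.exp (-(if D then I.arrivalRate i / I.abandonRate i else 0))) ≤
      streamLaw I i (⋃ n, voidEvent D t c n) := by
  have hl := I.arrivalRate_pos i
  have hm := I.abandonRate_pos i
  rw [measure_iUnion (disjoint_voidEvent D t hc) (measurableSet_voidEvent D t c)]
  simp_rw [fun n => streamLaw_voidEvent I i D hc n ht]
  rw [ENNReal.tsum_mul_left, tsum_thinMean hl hm ht, ← ENNReal.ofReal_mul (by positivity),
    ← Real.exp_add, ← Real.exp_add]
  refine ENNReal.ofReal_le_ofReal (Real.exp_le_exp.2 ?_)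
  have := thinMean_ge (D := D) hl hm t
  linarith

end Counting

/-! ### Restarting a Poisson stream at a fixed time -/

section Restart

/-- The number of arrivals before time `s`. -/
noncomputable def countBefore (s : ℝ) (z : ℕ → ℝ × ℝ) : ℕ := sInf {k | s ≤ arrTime z k}

/-- The arrivals from the `n`-th one on, with time counted from `s`. -/
def restartAt (n : ℕ) (s : ℝ) (z : ℕ → ℝ × ℝ) : ℕ → ℝ × ℝ :=
  cons (arrTime z n - s, (z n).2) fun m => z (n + m + 1)

/-- The arrivals from time `s` on, with time counted from `s`. -/
noncomputable def restart (s : ℝ) (z : ℕ → ℝ × ℝ) : ℕ → ℝ × ℝ :=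
  restartAt (countBefore s z) s z

lemma arrTime_restartAt (n : ℕ) (s : ℝ) (z : ℕ → ℝ × ℝ) (k : ℕ) :
    arrTime (restartAt n s z) k = arrTime z (n + k) - s := by
  induction k with
  | zero => simp [restartAt]
  | succ k ih =>
    rw [arrTime_succ, ih, ← add_assoc, arrTime_succ]
    simp [restartAt]
    ring

lemma depTime_restartAt (n : ℕ) (s : ℝ) (z : ℕ → ℝ × ℝ) (k : ℕ) :
    depTime (restartAt n s z) k = depTime z (n + k) - s := by
  unfold depTime
  rw [arrTime_restartAt]
  cases k with
  | zero => simp [restartAt]; ring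
  | succ k => simp [restartAt, add_assoc]; ring

/-- Exactly `n` agents arrive before time `s`. -/
def countEvent (n : ℕ) (s : ℝ) : Set (ℕ → ℝ × ℝ) :=
  {z | (∀ k < n, arrTime z k < s) ∧ s ≤ arrTime z n}

lemma measurableSet_countEvent (n : ℕ) (s : ℝ) : MeasurableSet (countEvent n s) := by
  refine measurableSet_setOfPred.2 (Measurable.and ?_ ?_)
  · refine Measurable.forall fun k => Measurable.imp measurable_const ?_
    exact measurableSet_setOfPred.1 (measurableSet_lt (by fun_prop) (by fun_prop))
  · exact measurableSet_setOfPred.1 (measurableSet_le (by fun_prop) (by fun_prop))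

lemma countBefore_eq {n : ℕ} {s : ℝ} {z : ℕ → ℝ × ℝ} (hz : z ∈ countEvent n s) :
    countBefore s z = n := by
  refine le_antisymm (Nat.sInf_le hz.2) ?_
  by_contra! h
  have h1 := Nat.sInf_mem (⟨n, hz.2⟩ : {k | s ≤ arrTime z k}.Nonempty)
  exact absurd (hz.1 _ h) (not_lt.2 h1)

lemma mem_countEvent {s : ℝ} {z : ℕ → ℝ × ℝ} (hz : ∃ k, s ≤ arrTime z k) :
    z ∈ countEvent (countBefore s z) s :=
  ⟨fun _ hk => not_le.1 (Nat.notMem_of_lt_sInf hk), Nat.sInf_mem hz⟩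

lemma disjoint_countEvent (s : ℝ) : Pairwise (Function.onFun Disjoint (countEvent · s)) :=
  fun _ _ hmn => Set.disjoint_left.2 fun _ hz hz' =>
    hmn ((countBefore_eq hz).symm.trans (countBefore_eq hz'))

@[fun_prop]
lemma measurable_restartAt (n : ℕ) (s : ℝ) : Measurable (restartAt n s) := by
  unfold restartAt
  refine measurable_cons.comp (f := fun z : ℕ → ℝ × ℝ =>
    ((arrTime z n - s, (z n).2), fun m => z (n + m + 1))) ?_
  fun_prop

lemma restart_eq {n : ℕ} {s : ℝ} {z : ℕ → ℝ × ℝ} (hz : z ∈ countEvent n s) :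
    restart s z = restartAt n s z := by
  rw [restart, countBefore_eq hz]

lemma measurable_restart (s : ℝ) : Measurable (restart s) := by
  -- The second piece covers streams without any arrival from `s` on: there the infimum of the empty
  -- set makes `countBefore` equal to `0`.
  have h : ∀ A, MeasurableSet A → restart s ⁻¹' A =
      (⋃ n, restartAt n s ⁻¹' A ∩ countEvent n s) ∪
        (restartAt 0 s ⁻¹' A ∩ (⋃ n, countEvent n s)ᶜ) := by
    intro A _
    ext z
    by_cases hz : ∃ k, s ≤ arrTime z k
    · have h1 := mem_countEvent hz
      have h2 : z ∈ ⋃ n, countEvent n s := Set.mem_iUnion.2 ⟨_, h1⟩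
      simp only [Set.mem_union, Set.mem_inter_iff, Set.mem_compl_iff, h2, not_true, and_false,
        or_false, Set.mem_iUnion, Set.mem_preimage]
      constructor
      · exact fun h => ⟨_, h, h1⟩
      · rintro ⟨n, h, hn⟩
        rwa [restart_eq hn]
    · have h2 : ∀ n, z ∉ countEvent n s := fun n hn => hz ⟨n, hn.2⟩
      have h3 : countBefore s z = 0 := by
        have : {k | s ≤ arrTime z k} = ∅ := Set.eq_empty_of_forall_notMem fun k hk => hz ⟨k, hk⟩
        rw [countBefore, this, Nat.sInf_empty]
      simp [h2, restart, h3]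
  intro A hA
  rw [h A hA]
  have hc := fun n => measurableSet_countEvent n s
  exact (MeasurableSet.iUnion fun n => ((measurable_restartAt n s) hA).inter (hc n)).union
    (((measurable_restartAt 0 s) hA).inter (MeasurableSet.iUnion hc).compl)

variable {T : Type*} (I : Instance T) (i : T)

/-- This is the memorylessness of the first interarrival time; the first sojourn time and all later
marks are unaffected. -/
lemma streamLaw_restartAt_zero {A : Set (ℕ → ℝ × ℝ)} (hA : MeasurableSet A) {s : ℝ} (hs : 0 ≤ s) :
    streamLaw I i (restartAt 0 s ⁻¹' A ∩ countEvent 0 s) =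
      ENNReal.ofReal (Real.exp (-(I.arrivalRate i * s))) * streamLaw I i A := by
  have hl := I.arrivalRate_pos i
  have := isProbabilityMeasure_expMeasure hl
  have := isProbabilityMeasure_expMeasure (I.abandonRate_pos i)
  obtain ⟨H, hH⟩ : ∃ H : ℝ × ℝ → ℝ≥0∞, H = fun x => streamLaw I i {z | cons x z ∈ A} := ⟨_, rfl⟩
  have hHm : Measurable H := by
    rw [hH]
    exact measurable_measure_prodMk_left (measurable_cons hA)
  have hSm : Measurable ((Set.Ici s).indicator (1 : ℝ → ℝ≥0∞)) :=
    measurable_one.indicator measurableSet_Ici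
  have h1 : ∀ x : ℝ × ℝ, streamLaw I i {z | cons x z ∈ restartAt 0 s ⁻¹' A ∩ countEvent 0 s} =
      (Set.Ici s).indicator 1 x.1 * H (x.1 - s, x.2) := by
    intro x
    have h2 : {z | cons x z ∈ restartAt 0 s ⁻¹' A ∩ countEvent 0 s} =
        {z | s ≤ x.1 ∧ cons (x.1 - s, x.2) z ∈ A} := by
      ext z
      simp [restartAt, countEvent, and_comm]
    rw [h2]
    by_cases hx : s ≤ x.1
    · rw [Set.indicator_of_mem (show x.1 ∈ Set.Ici s from hx), hH]
      simp [hx]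
    · rw [Set.indicator_of_notMem (show x.1 ∉ Set.Ici s from hx)]
      simp [hx]
  rw [streamLaw_apply _ _ (((measurable_restartAt 0 s) hA).inter (measurableSet_countEvent 0 s)),
    streamLaw_apply _ _ hA]
  simp_rw [h1]
  rw [lintegral_markLaw _ _ (by fun_prop), ← hH, lintegral_markLaw _ _ hHm]
  obtain ⟨h, hh⟩ : ∃ h : ℝ → ℝ≥0∞, h = fun u => ∫⁻ v, H (u, v) ∂expMeasure (I.abandonRate i) :=
    ⟨_, rfl⟩
  have hhm : Measurable h := by
    rw [hh]
    exact hHm.lintegral_prod_right'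
  have h3 : ∀ u : ℝ, ∫⁻ v, (Set.Ici s).indicator 1 u * H (u - s, v)
      ∂expMeasure (I.abandonRate i) = (Set.Ici s).indicator 1 u * h (u - s) := fun u => by
    rw [lintegral_const_mul _ (by fun_prop), hh]
  simp only
  simp_rw [h3]
  rw [← hh, lintegral_expMeasure _ (by fun_prop), lintegral_expMeasure _ hhm,
    ← lintegral_const_mul' _ _ ENNReal.ofReal_ne_top, ← lintegral_indicator measurableSet_Ioi,
    ← lintegral_indicator measurableSet_Ioi, ← lintegral_add_right_eq_self _ s]
  refine lintegral_congr_ae ?_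
  -- At `u = 0` the closed ray from `s` and the open ray from `0` may disagree; this is a null set.
  filter_upwards [Measure.ae_ne volume (0 : ℝ)] with u hu
  rcases lt_or_gt_of_ne hu with h0 | h0
  · rw [Set.indicator_of_notMem (show u ∉ Set.Ioi 0 from not_lt.2 h0.le)]
    by_cases h4 : u + s ∈ Set.Ioi 0
    · rw [Set.indicator_of_mem h4, Set.indicator_of_notMem (show u + s ∉ Set.Ici s from
        fun h => by have := Set.mem_Ici.1 h; linarith)]
      simp
    · rw [Set.indicator_of_notMem h4]
  · rw [Set.indicator_of_mem (show u ∈ Set.Ioi 0 from h0),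
      Set.indicator_of_mem (show u + s ∈ Set.Ioi 0 from by simp only [Set.mem_Ioi]; linarith),
      Set.indicator_of_mem (show u + s ∈ Set.Ici s from by simp only [Set.mem_Ici]; linarith),
      add_sub_cancel_right, Pi.one_apply, one_mul, ← mul_assoc,
      ← ENNReal.ofReal_mul (by positivity)]
    congr 2
    rw [mul_add, neg_add, Real.exp_add]
    ring

/-- Induction on `n`: removing a first arrival at `u < s` leaves `n - 1` arrivals before `s - u` and
the same restarted stream. Memorylessness enters only at `n = 0`. -/
lemma streamLaw_restartAt {A : Set (ℕ → ℝ × ℝ)} (hA : MeasurableSet A) (n : ℕ) {s : ℝ}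
    (hs : 0 ≤ s) :
    streamLaw I i (restartAt n s ⁻¹' A ∩ countEvent n s) =
      streamLaw I i (countEvent n s) * streamLaw I i A := by
  induction n generalizing s with
  | zero =>
    have h := streamLaw_restartAt_zero I i MeasurableSet.univ hs
    rw [Set.preimage_univ, Set.univ_inter, measure_univ, mul_one] at h
    rw [h, streamLaw_restartAt_zero I i hA hs]
  | succ n ih =>
    have h1 : ∀ x : ℝ × ℝ, ∀ B : Set (ℕ → ℝ × ℝ),
        {z | cons x z ∈ restartAt (n + 1) s ⁻¹' B ∩ countEvent (n + 1) s} =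
        {z | x.1 < s ∧ z ∈ restartAt n (s - x.1) ⁻¹' B ∩ countEvent n (s - x.1)} := by
      intro x B
      ext z
      have h2 : restartAt (n + 1) s (cons x z) = restartAt n (s - x.1) z := by
        have : (fun m => z (n + 1 + m)) = fun m => z (n + m + 1) :=
          funext fun m => congrArg z (by omega)
        simp only [restartAt, arrTime_cons_succ, cons_succ, this]
        congr 2
        ring
      have h3 : cons x z ∈ countEvent (n + 1) s ↔ x.1 < s ∧ z ∈ countEvent n (s - x.1) := by
        simp only [countEvent, Set.mem_ofPred_eq, arrTime_cons_succ]
        constructor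
        · rintro ⟨ha, hb⟩
          refine ⟨by simpa using ha 0 (by omega), fun k hk => ?_, by linarith⟩
          have := ha (k + 1) (by omega)
          rw [arrTime_cons_succ] at this
          linarith
        · rintro ⟨h0, ha, hb⟩
          refine ⟨fun k hk => ?_, by linarith⟩
          cases k with
          | zero => simpa using h0
          | succ k =>
            rw [arrTime_cons_succ]
            linarith [ha k (by omega)]
      simp only [Set.mem_ofPred_eq, Set.mem_inter_iff, Set.mem_preimage, h2, h3]
      tauto
    have h4 : streamLaw I i (countEvent (n + 1) s) =
        ∫⁻ x, streamLaw I i {z | x.1 < s ∧ z ∈ countEvent n (s - x.1)} ∂markLaw I i := by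
      rw [streamLaw_apply _ _ (measurableSet_countEvent (n + 1) s)]
      refine lintegral_congr fun x => ?_
      have := h1 x Set.univ
      simp only [Set.preimage_univ, Set.univ_inter] at this
      rw [this]
    rw [streamLaw_apply _ _ (((measurable_restartAt (n + 1) s) hA).inter
      (measurableSet_countEvent (n + 1) s)), h4,
      ← lintegral_mul_const' _ _ (measure_ne_top _ _)]
    refine lintegral_congr fun x => ?_
    rw [h1]
    by_cases hx : x.1 < s
    · simp only [hx, true_and, Set.ofPred_mem_eq]
      exact ih (by linarith)
    · simp [hx]

/-- The Poisson stream of type `i` started afresh at time `s` has the original law. -/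
lemma measurePreserving_restart {s : ℝ} (hs : 0 ≤ s) :
    MeasurePreserving (restart s) (streamLaw I i) (streamLaw I i) := by
  refine ⟨measurable_restart s, Measure.ext fun A hA => ?_⟩
  rw [Measure.map_apply (measurable_restart s) hA]
  have h0 : (⋃ n, countEvent n s) =ᵐ[streamLaw I i] Set.univ := by
    refine eventuallyEq_univ.2 ?_
    filter_upwards [ae_unbounded_arrTime I i] with z hz
    exact Set.mem_iUnion.2 ⟨_, mem_countEvent (hz s)⟩
  have h1 : streamLaw I i (restart s ⁻¹' A) =
      streamLaw I i (⋃ n, restartAt n s ⁻¹' A ∩ countEvent n s) := by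
    have h2 : (⋃ n, restartAt n s ⁻¹' A ∩ countEvent n s) =
        restart s ⁻¹' A ∩ ⋃ n, countEvent n s := by
      rw [Set.inter_iUnion]
      refine Set.iUnion_congr fun n => ?_
      ext z
      simp only [Set.mem_inter_iff, Set.mem_preimage]
      exact and_congr_left fun hz => by rw [restart_eq hz]
    rw [h2]
    refine (measure_congr ?_).symm
    simpa using (ae_eq_refl (restart s ⁻¹' A)).inter h0
  rw [h1, measure_iUnion
    (fun m n hmn => ((disjoint_countEvent s hmn).mono Set.inter_subset_right
      Set.inter_subset_right))
    (fun n => ((measurable_restartAt n s) hA).inter (measurableSet_countEvent n s))]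
  simp_rw [fun n => streamLaw_restartAt I i hA n hs]
  rw [ENNReal.tsum_mul_right, ← measure_iUnion (disjoint_countEvent s)
    (fun n => measurableSet_countEvent n s), measure_congr h0, measure_univ, one_mul]

end Restart

end DynMatch

namespace DynMatch

open scoped ENNReal

/-! ### Matchings of agents labelled by type and rank -/

section IndexMatching

variable {T : Type*}

/-- Positive interarrival and sojourn times, and finitely many arrivals in bounded time. -/
def Regular (z : T → ℕ → ℝ × ℝ) : Prop :=
  ∀ i, (∀ k, 0 < (z i k).1 ∧ 0 < (z i k).2) ∧ ∀ t, ∃ k, t ≤ arrTime (z i) k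

/-- Agents are referred to by their type and rank; the pairs of a set are disjoint. -/
def IsIndexMatching (E : Finset ((T × ℕ) × (T × ℕ))) : Prop :=
  ∀ e ∈ E, ∀ e' ∈ E, e.1 = e'.1 ∨ e.1 = e'.2 ∨ e.2 = e'.1 ∨ e.2 = e'.2 → e = e'

/-- The first agent of the pair arrives before the second one, who arrives before `t` and while the
first one is present. -/
def Compatible (t : ℝ) (z : T → ℕ → ℝ × ℝ) (e : (T × ℕ) × (T × ℕ)) : Prop :=
  arrTime (z e.1.1) e.1.2 < arrTime (z e.2.1) e.2.2 ∧ arrTime (z e.2.1) e.2.2 < t ∧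
    arrTime (z e.2.1) e.2.2 ≤ depTime (z e.1.1) e.1.2

/-- A matching of compatible agents. -/
def Valid (t : ℝ) (z : T → ℕ → ℝ × ℝ) (E : Finset ((T × ℕ) × (T × ℕ))) : Prop :=
  IsIndexMatching E ∧ ∀ e ∈ E, Compatible t z e

lemma valid_empty (t : ℝ) (z : T → ℕ → ℝ × ℝ) : Valid t z ∅ := by
  simp [Valid, IsIndexMatching]

lemma Valid.mono {s t : ℝ} (hst : s ≤ t) {z : T → ℕ → ℝ × ℝ} {E : Finset ((T × ℕ) × (T × ℕ))}
    (h : Valid s z E) : Valid t z E :=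
  ⟨h.1, fun e he => ⟨(h.2 e he).1, (h.2 e he).2.1.trans_le hst, (h.2 e he).2.2⟩⟩

variable (I : Instance T)

/-- The total reward of a set of pairs of agents. -/
def indexValue (E : Finset ((T × ℕ) × (T × ℕ))) : ℝ := ∑ e ∈ E, I.reward e.1.1 e.2.1

open Classical in
/-- The largest total reward of a valid matching. -/
noncomputable def optReward (t : ℝ) (z : T → ℕ → ℝ × ℝ) : ℝ :=
  ⨆ E : Finset ((T × ℕ) × (T × ℕ)), if Valid t z E then indexValue I E else 0

/-- The number of arrivals before time `t`. -/
noncomputable def arrivalCount (t : ℝ) (z : T → ℕ → ℝ × ℝ) : ℝ≥0∞ :=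
  ∑' p : T × ℕ, {z : T → ℕ → ℝ × ℝ | arrTime (z p.1) p.2 < t}.indicator 1 z

/-- The earlier agents of the pairs are distinct and arrive before `t`. This makes `arrivalCount`
the integrable dominating function for all rewards and pair counts. -/
lemma Valid.card_le {t : ℝ} {z : T → ℕ → ℝ × ℝ} {E : Finset ((T × ℕ) × (T × ℕ))}
    (h : Valid t z E) : (E.card : ℝ≥0∞) ≤ arrivalCount t z := by
  classical
  have h1 : Set.InjOn Prod.fst (E : Set ((T × ℕ) × (T × ℕ))) := fun e he e' he' hee =>
    h.1 e he e' he' (Or.inl hee)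
  calc (E.card : ℝ≥0∞) = ((E.image Prod.fst).card : ℝ≥0∞) := by
        rw [Finset.card_image_of_injOn h1]
    _ = ∑ p ∈ E.image Prod.fst,
        {z : T → ℕ → ℝ × ℝ | arrTime (z p.1) p.2 < t}.indicator 1 z := by
        rw [Finset.card_eq_sum_ones, Nat.cast_sum]
        refine Finset.sum_congr rfl fun p hp => ?_
        obtain ⟨e, he, rfl⟩ := Finset.mem_image.1 hp
        rw [Set.indicator_of_mem (show z ∈ {z : T → ℕ → ℝ × ℝ | arrTime (z e.1.1) e.1.2 < t} from
          (h.2 e he).1.trans (h.2 e he).2.1)]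
        simp
    _ ≤ arrivalCount t z := ENNReal.sum_le_tsum _

lemma Regular.finite_setOf_arrTime_lt [Finite T] {z : T → ℕ → ℝ × ℝ} (hz : Regular z) (t : ℝ) :
    {p : T × ℕ | arrTime (z p.1) p.2 < t}.Finite := by
  choose k hk using fun i => (hz i).2 t
  refine Set.Finite.subset (Set.finite_iUnion fun i =>
    (Set.finite_Iio (k i)).image (fun n => ((i, n) : T × ℕ))) fun p hp => ?_
  refine Set.mem_iUnion.2 ⟨p.1, p.2, ?_, rfl⟩
  by_contra h
  have h1 := (strictMono_arrTime fun n => ((hz p.1).1 n).1).monotone (not_lt.1 h)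
  exact absurd hp (not_lt.2 ((hk p.1).trans h1))

lemma Regular.finite_setOf_valid [Finite T] {z : T → ℕ → ℝ × ℝ} (hz : Regular z) (t : ℝ) :
    {E | Valid t z E}.Finite := by
  have h := hz.finite_setOf_arrTime_lt t
  refine Set.Finite.subset ((h.prod h).toFinset.powerset.finite_toSet) fun E hE => ?_
  simp only [Finset.coe_powerset, Set.mem_preimage, Set.mem_powerset_iff]
  intro e he
  have h1 := hE.2 e he
  simpa using ⟨h1.1.trans h1.2.1, h1.2.1⟩

/-- The default value `0` in `optReward` is harmless, since the empty matching is valid and has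
value `0`. -/
lemma bddAbove_valid {t : ℝ} {z : T → ℕ → ℝ × ℝ} {E : Finset ((T × ℕ) × (T × ℕ))}
    (hmax : ∀ E', Valid t z E' → indexValue I E' ≤ indexValue I E) (E' : Finset ((T × ℕ) × (T × ℕ)))
    [Decidable (Valid t z E')] :
    (if Valid t z E' then indexValue I E' else 0) ≤ indexValue I E := by
  split_ifs with h
  · exact hmax _ h
  · simpa [indexValue] using hmax ∅ (valid_empty t z)

lemma Regular.exists_optReward [Finite T] {z : T → ℕ → ℝ × ℝ} (hz : Regular z) (t : ℝ) :
    ∃ E, Valid t z E ∧ optReward I t z = indexValue I E ∧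
      ∀ E', Valid t z E' → indexValue I E' ≤ indexValue I E := by
  classical
  obtain ⟨E, hE, hmax⟩ := Set.exists_max_image _ (indexValue I) (hz.finite_setOf_valid t)
    ⟨∅, valid_empty t z⟩
  refine ⟨E, hE, le_antisymm (ciSup_le fun E' => bddAbove_valid I hmax E') ?_, hmax⟩
  have h := le_ciSup (f := fun E => if Valid t z E then indexValue I E else 0)
    ⟨indexValue I E, by rintro _ ⟨E', rfl⟩; exact bddAbove_valid I hmax E'⟩ E
  simp only [if_pos (show Valid t z E from hE)] at h
  exact h

lemma Regular.indexValue_le [Finite T] {z : T → ℕ → ℝ × ℝ} (hz : Regular z) {t : ℝ}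
    {E : Finset ((T × ℕ) × (T × ℕ))} (hE : Valid t z E) : indexValue I E ≤ optReward I t z := by
  obtain ⟨E', _, h, hmax⟩ := hz.exists_optReward I t
  exact h ▸ hmax E hE

lemma Regular.optReward_mono [Finite T] {z : T → ℕ → ℝ × ℝ} (hz : Regular z) {s t : ℝ}
    (hst : s ≤ t) : optReward I s z ≤ optReward I t z := by
  obtain ⟨E, hE, h, _⟩ := hz.exists_optReward I s
  exact h ▸ hz.indexValue_le I (hE.mono hst)

lemma Regular.arrivalCount_lt_top [Finite T] {z : T → ℕ → ℝ × ℝ} (hz : Regular z) (t : ℝ) :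
    arrivalCount t z < ∞ := by
  have h := hz.finite_setOf_arrTime_lt t
  unfold arrivalCount
  rw [tsum_eq_sum (s := h.toFinset)]
  · exact ENNReal.sum_lt_top.2 fun p _ => lt_of_le_of_lt (Set.indicator_le_self _ _ _) (by simp)
  · intro p hp
    refine Set.indicator_of_notMem (fun h' => hp ?_) _
    simpa using h'

/-- A bound of the absolute values of all rewards. -/
def rewardBound [Fintype T] : ℝ := ∑ i, ∑ j, |I.reward i j|

lemma abs_reward_le [Fintype T] (i j : T) : |I.reward i j| ≤ rewardBound I :=
  (Finset.single_le_sum (f := fun j => |I.reward i j|) (fun _ _ => abs_nonneg _)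
    (Finset.mem_univ j)).trans
    (Finset.single_le_sum (f := fun i => ∑ j, |I.reward i j|)
      (fun _ _ => Finset.sum_nonneg fun _ _ => abs_nonneg _) (Finset.mem_univ i))

lemma rewardBound_nonneg [Fintype T] : 0 ≤ rewardBound I :=
  Finset.sum_nonneg fun _ _ => Finset.sum_nonneg fun _ _ => abs_nonneg _

lemma Valid.card_le_toReal [Finite T] {t : ℝ} {z : T → ℕ → ℝ × ℝ} (hz : Regular z)
    {E : Finset ((T × ℕ) × (T × ℕ))} (h : Valid t z E) :
    (E.card : ℝ) ≤ (arrivalCount t z).toReal := by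
  simpa using (ENNReal.toReal_le_toReal (by simp) (hz.arrivalCount_lt_top t).ne).2 h.card_le

lemma Valid.abs_indexValue_le [Fintype T] {t : ℝ} {z : T → ℕ → ℝ × ℝ} (hz : Regular z)
    {E : Finset ((T × ℕ) × (T × ℕ))} (h : Valid t z E) :
    |indexValue I E| ≤ rewardBound I * (arrivalCount t z).toReal := by
  calc |indexValue I E| ≤ ∑ e ∈ E, |I.reward e.1.1 e.2.1| := Finset.abs_sum_le_sum_abs _ _
    _ ≤ ∑ e ∈ E, rewardBound I := Finset.sum_le_sum fun e _ => abs_reward_le I _ _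
    _ = rewardBound I * E.card := by rw [Finset.sum_const, nsmul_eq_mul, mul_comm]
    _ ≤ _ := mul_le_mul_of_nonneg_left (h.card_le_toReal hz) (rewardBound_nonneg I)

lemma Regular.abs_optReward_le [Fintype T] {z : T → ℕ → ℝ × ℝ} (hz : Regular z) (t : ℝ) :
    |optReward I t z| ≤ rewardBound I * (arrivalCount t z).toReal := by
  obtain ⟨E, hE, h, _⟩ := hz.exists_optReward I t
  exact h ▸ hE.abs_indexValue_le I hz

lemma measurableSet_valid [Countable T] (t : ℝ) (E : Finset ((T × ℕ) × (T × ℕ))) :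
    MeasurableSet {z | Valid t z E} := by
  refine measurableSet_setOfPred.2 (Measurable.and measurable_const (Measurable.forall fun e =>
    Measurable.imp measurable_const (Measurable.and ?_ (Measurable.and ?_ ?_))))
  · exact measurableSet_setOfPred.1 (measurableSet_lt
      ((measurable_arrTime _).comp (measurable_pi_apply _))
      ((measurable_arrTime _).comp (measurable_pi_apply _)))
  · exact measurableSet_setOfPred.1 (measurableSet_lt
      ((measurable_arrTime _).comp (measurable_pi_apply _)) measurable_const)
  · exact measurableSet_setOfPred.1 (measurableSet_le
      ((measurable_arrTime _).comp (measurable_pi_apply _))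
      ((measurable_depTime _).comp (measurable_pi_apply _)))

/-- The candidates are finite sets of labels, hence countably many and independent of `z`; only
their validity is random. -/
lemma measurable_optReward [Countable T] (t : ℝ) : Measurable (optReward I t) := by
  classical
  refine Measurable.iSup fun E => ?_
  exact Measurable.ite (measurableSet_valid t E) measurable_const measurable_const

lemma measurableSet_arrTime_lt (p : T × ℕ) (t : ℝ) :
    MeasurableSet {z : T → ℕ → ℝ × ℝ | arrTime (z p.1) p.2 < t} :=
  measurableSet_lt ((measurable_arrTime _).comp (measurable_pi_apply _)) measurable_const

lemma measurable_arrivalCount [Countable T] (t : ℝ) :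
    Measurable (arrivalCount t : (T → ℕ → ℝ × ℝ) → ℝ≥0∞) :=
  Measurable.tsum fun p => measurable_one.indicator (measurableSet_arrTime_lt p t)

/-- The total reward of a valid matching of the agents up to time `s` and of one of the agents
between `s` and `s + t`. -/
lemma Regular.optReward_add_le [Finite T] {z : T → ℕ → ℝ × ℝ} (hz : Regular z) {s t : ℝ}
    (ht : 0 ≤ t) (hz' : Regular fun i => restart s (z i)) :
    optReward I s z + optReward I t (fun i => restart s (z i)) ≤ optReward I (s + t) z := by
  classical
  obtain ⟨E, hE, h, _⟩ := hz.exists_optReward I s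
  obtain ⟨E', hE', h', _⟩ := hz'.exists_optReward I t
  -- After the restart, rank `k` of type `i` is rank `K i + k` of the original stream. The
  -- relabelled agents arrive no earlier than `s`, so they are disjoint from those matched before
  -- `s`.
  set K : T → ℕ := fun i => countBefore s (z i)
  have harr : ∀ p : T × ℕ, arrTime (restart s (z p.1)) p.2 =
      arrTime (z p.1) (K p.1 + p.2) - s := fun p => arrTime_restartAt _ _ _ _
  have hdep : ∀ p : T × ℕ, depTime (restart s (z p.1)) p.2 =
      depTime (z p.1) (K p.1 + p.2) - s := fun p => depTime_restartAt _ _ _ _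
  let σ : T × ℕ ↪ T × ℕ := ⟨fun p => (p.1, K p.1 + p.2), fun p q hpq => by
    obtain ⟨i, k⟩ := p
    obtain ⟨j, l⟩ := q
    simp only [Prod.mk.injEq] at hpq
    obtain ⟨rfl, hpq⟩ := hpq
    simpa using hpq⟩
  have hlate : ∀ p, s ≤ arrTime (z (σ p).1) (σ p).2 := by
    intro p
    have h1 := (mem_countEvent ((hz p.1).2 s)).2
    exact h1.trans ((strictMono_arrTime fun n => ((hz p.1).1 n).1).monotone (Nat.le_add_right _ _))
  have hdisj : ∀ e ∈ E, ∀ e' ∈ E', ¬ (e.1 = σ e'.1 ∨ e.1 = σ e'.2 ∨ e.2 = σ e'.1 ∨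
      e.2 = σ e'.2) := by
    intro e he e' _ hee
    have h1 := (hE.2 e he).2.1
    have h2 := (hE.2 e he).1.trans h1
    rcases hee with hee | hee | hee | hee
    · rw [hee] at h2; exact absurd h2 (not_lt.2 (hlate _))
    · rw [hee] at h2; exact absurd h2 (not_lt.2 (hlate _))
    · rw [hee] at h1; exact absurd h1 (not_lt.2 (hlate _))
    · rw [hee] at h1; exact absurd h1 (not_lt.2 (hlate _))
  have hval : Valid (s + t) z (E ∪ E'.map (σ.prodMap σ)) := by
    refine ⟨fun e he f hf hef => ?_, fun e he => ?_⟩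
    · rw [Finset.mem_union, Finset.mem_map] at he hf
      rcases he with he | ⟨e', he', rfl⟩ <;> rcases hf with hf | ⟨f', hf', rfl⟩
      · exact hE.1 e he f hf hef
      · exact absurd hef (hdisj e he f' hf')
      · refine absurd ?_ (hdisj f hf e' he')
        simp only [Function.Embedding.coe_prodMap, Prod.map_fst, Prod.map_snd] at hef
        rcases hef with h | h | h | h <;> simp [h]
      · simp only [Function.Embedding.coe_prodMap, Prod.map_fst, Prod.map_snd,
          EmbeddingLike.apply_eq_iff_eq] at hef
        rw [hE'.1 e' he' f' hf' hef]
    · rw [Finset.mem_union, Finset.mem_map] at he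
      rcases he with he | ⟨e', he', rfl⟩
      · exact (hE.mono (by linarith)).2 e he
      · obtain ⟨h1, h2, h3⟩ := hE'.2 e' he'
        rw [harr] at h1 h2 h3
        rw [harr] at h1
        rw [hdep] at h3
        refine ⟨?_, ?_, ?_⟩
        · change arrTime (z e'.1.1) (K e'.1.1 + e'.1.2) < arrTime (z e'.2.1) (K e'.2.1 + e'.2.2)
          linarith
        · change arrTime (z e'.2.1) (K e'.2.1 + e'.2.2) < s + t
          linarith
        · change arrTime (z e'.2.1) (K e'.2.1 + e'.2.2) ≤ depTime (z e'.1.1) (K e'.1.1 + e'.1.2)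
          linarith
  have hd : Disjoint E (E'.map (σ.prodMap σ)) := by
    refine Finset.disjoint_left.2 fun e he he' => ?_
    obtain ⟨e', hmem, rfl⟩ := Finset.mem_map.1 he'
    exact hdisj _ he e' hmem (Or.inl rfl)
  refine le_trans (le_of_eq ?_) (hz.indexValue_le I hval)
  rw [h, h', indexValue, indexValue, indexValue, Finset.sum_union hd, Finset.sum_map]
  rfl

end IndexMatching

/-! ### Mean optimal reward and existence of the limit -/

section MarketLaw

variable {T : Type*} [Fintype T] (I : Instance T)

/-- The law of all (interarrival time, sojourn time) pairs. -/
noncomputable def marketLaw : Measure (T → ℕ → ℝ × ℝ) := Measure.pi (streamLaw I)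

instance isProbabilityMeasure_marketLaw : IsProbabilityMeasure (marketLaw I) := by
  unfold marketLaw
  infer_instance

lemma measurePreserving_eval_marketLaw (i : T) :
    MeasurePreserving (Function.eval i) (marketLaw I) (streamLaw I i) :=
  measurePreserving_eval (streamLaw I) i

lemma ae_regular : ∀ᵐ z ∂marketLaw I, Regular z := by
  refine ae_all_iff.2 fun i => ?_
  exact (measurePreserving_eval_marketLaw I i).quasiMeasurePreserving.ae
    ((ae_pos_streamLaw I i).and (ae_unbounded_arrTime I i))

lemma marketLaw_arrTime_lt (p : T × ℕ) (t : ℝ) :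
    marketLaw I {z | arrTime (z p.1) p.2 < t} = streamLaw I p.1 {z | arrTime z p.2 < t} :=
  (measurePreserving_eval_marketLaw I p.1).measure_preimage
    (s := {z | arrTime z p.2 < t})
    (measurableSet_lt (by fun_prop) (by fun_prop)).nullMeasurableSet

lemma lintegral_arrivalCount (t : ℝ) :
    ∫⁻ z, arrivalCount t z ∂marketLaw I =
      ENNReal.ofReal (∑ i, I.arrivalRate i) * ENNReal.ofReal t := by
  unfold arrivalCount
  rw [lintegral_tsum fun p =>
    (measurable_one.indicator (measurableSet_arrTime_lt p t)).aemeasurable]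
  simp_rw [fun p : T × ℕ => lintegral_indicator_one (μ := marketLaw I)
    (measurableSet_arrTime_lt p t), marketLaw_arrTime_lt]
  rw [ENNReal.tsum_prod (f := fun i k => streamLaw I i {z | arrTime z k < t}), tsum_fintype]
  simp_rw [tsum_streamLaw_arrTime_lt]
  rw [← Finset.sum_mul, ENNReal.ofReal_sum_of_nonneg fun i _ => (I.arrivalRate_pos i).le]

lemma lintegral_arrivalCount_ne_top (t : ℝ) : ∫⁻ z, arrivalCount t z ∂marketLaw I ≠ ∞ := by
  rw [lintegral_arrivalCount]
  exact ENNReal.mul_ne_top ENNReal.ofReal_ne_top ENNReal.ofReal_ne_top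

lemma integrable_arrivalCount (t : ℝ) :
    Integrable (fun z => (arrivalCount t z).toReal) (marketLaw I) :=
  integrable_toReal_of_lintegral_ne_top (measurable_arrivalCount t).aemeasurable
    (lintegral_arrivalCount_ne_top I t)

lemma integral_arrivalCount {t : ℝ} (ht : 0 ≤ t) :
    ∫ z, (arrivalCount t z).toReal ∂marketLaw I = (∑ i, I.arrivalRate i) * t := by
  rw [integral_toReal (measurable_arrivalCount t).aemeasurable, lintegral_arrivalCount,
    ENNReal.toReal_mul, ENNReal.toReal_ofReal, ENNReal.toReal_ofReal ht]
  · exact Finset.sum_nonneg fun i _ => (I.arrivalRate_pos i).le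
  · filter_upwards [ae_regular I] with z hz using hz.arrivalCount_lt_top t

lemma integrable_optReward (t : ℝ) : Integrable (optReward I t) (marketLaw I) := by
  refine ((integrable_arrivalCount I t).const_mul (rewardBound I)).mono'
    (measurable_optReward I t).aestronglyMeasurable ?_
  filter_upwards [ae_regular I] with z hz
  exact hz.abs_optReward_le I t

/-- The expected optimal total reward by time `t`. -/
noncomputable def meanOpt (t : ℝ) : ℝ := ∫ z, optReward I t z ∂marketLaw I

lemma meanOpt_mono : Monotone (meanOpt I) := by
  intro s t hst
  refine integral_mono_ae (integrable_optReward I s) (integrable_optReward I t) ?_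
  filter_upwards [ae_regular I] with z hz using hz.optReward_mono I hst

lemma meanOpt_le {t : ℝ} (ht : 0 ≤ t) :
    meanOpt I t ≤ rewardBound I * (∑ i, I.arrivalRate i) * t := by
  rw [mul_assoc, ← integral_arrivalCount I ht, ← integral_const_mul]
  refine integral_mono_ae (integrable_optReward I t)
    ((integrable_arrivalCount I t).const_mul _) ?_
  filter_upwards [ae_regular I] with z hz using (le_abs_self _).trans (hz.abs_optReward_le I t)

/-- Pairs that straddle time `s` are given up. Only the law of the restarted market matters, not its
independence of the past. -/
lemma meanOpt_add_le {s t : ℝ} (hs : 0 ≤ s) (ht : 0 ≤ t) :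
    meanOpt I s + meanOpt I t ≤ meanOpt I (s + t) := by
  have hmp : MeasurePreserving (fun (z : T → ℕ → ℝ × ℝ) i => restart s (z i)) (marketLaw I)
      (marketLaw I) :=
    measurePreserving_pi (streamLaw I) (streamLaw I) fun i => measurePreserving_restart I i hs
  have h1 : meanOpt I t = ∫ z, optReward I t (fun i => restart s (z i)) ∂marketLaw I := by
    rw [meanOpt, ← hmp.map_eq, integral_map hmp.aemeasurable
      (measurable_optReward I t).aestronglyMeasurable, hmp.map_eq]
  have h2 : Integrable (fun z => optReward I t (fun i => restart s (z i))) (marketLaw I) :=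
    (hmp.integrable_comp (measurable_optReward I t).aestronglyMeasurable).2
      (integrable_optReward I t)
  rw [h1, meanOpt, ← integral_add (integrable_optReward I s) h2]
  refine integral_mono_ae ((integrable_optReward I s).add h2) (integrable_optReward I _) ?_
  filter_upwards [ae_regular I, hmp.quasiMeasurePreserving.ae (ae_regular I)] with z hz hz'
  exact hz.optReward_add_le I ht hz'

/-- Fekete's lemma for monotone superadditive functions on the positive reals. -/
lemma exists_tendsto_div_of_superadditive {f : ℝ → ℝ} (hf : Monotone f)
    (hadd : ∀ s t, 0 ≤ s → 0 ≤ t → f s + f t ≤ f (s + t)) {C : ℝ} (hC : ∀ t, 0 ≤ t → f t ≤ C * t) :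
    ∃ L, Tendsto (fun t => 1 / t * f t) atTop (𝓝 L) := by
  have hsub : Subadditive fun n : ℕ => -f n := by
    intro m n
    have := hadd m n m.cast_nonneg n.cast_nonneg
    push_cast
    linarith
  have hbdd : BddBelow (Set.range fun n : ℕ => -f n / n) := by
    -- The `0` covers `n = 0`, where the quotient is `0` by convention.
    refine ⟨min 0 (-C), ?_⟩
    rintro _ ⟨n, rfl⟩
    rcases Nat.eq_zero_or_pos n with rfl | hn
    · simp
    · have hn' : (0 : ℝ) < n := by exact_mod_cast hn
      refine (min_le_right _ _).trans ?_
      rw [le_div_iff₀ hn']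
      linarith [hC n hn'.le]
  have h := (hsub.tendsto_lim hbdd).neg
  have h' : Tendsto (fun n : ℕ => f n / n) atTop (𝓝 (-hsub.lim)) := by
    refine h.congr fun n => ?_
    ring
  refine ⟨-hsub.lim, ?_⟩
  -- By monotonicity `f t` lies between `f ⌊t⌋₊` and `f ⌈t⌉₊`, and both `⌊t⌋₊ / t` and `⌈t⌉₊ / t`
  -- tend to `1`.
  have hlow := (h'.comp tendsto_nat_floor_atTop).mul (tendsto_nat_floor_div_atTop (R := ℝ))
  have hup := (h'.comp tendsto_nat_ceil_atTop).mul (tendsto_nat_ceil_div_atTop (R := ℝ))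
  rw [mul_one] at hlow hup
  refine tendsto_of_tendsto_of_tendsto_of_le_of_le' hlow hup ?_ ?_
  · filter_upwards [eventually_ge_atTop (1 : ℝ)] with t ht
    have h0 : (0 : ℝ) < t := by linarith
    have h1 : (0 : ℝ) < ⌊t⌋₊ := by exact_mod_cast Nat.floor_pos.2 ht
    have h2 := hf (Nat.floor_le h0.le)
    simp only [Function.comp_apply]
    rw [div_mul_div_cancel₀ h1.ne', one_div, inv_mul_eq_div]
    gcongr
  · filter_upwards [eventually_ge_atTop (1 : ℝ)] with t ht
    have h0 : (0 : ℝ) < t := by linarith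
    have h1 : (0 : ℝ) < ⌈t⌉₊ := by exact_mod_cast Nat.ceil_pos.2 h0
    have h2 := hf (Nat.le_ceil t)
    simp only [Function.comp_apply]
    rw [div_mul_div_cancel₀ h1.ne', one_div, inv_mul_eq_div]
    gcongr

lemma exists_tendsto_meanOpt : ∃ L, Tendsto (fun t => 1 / t * meanOpt I t) atTop (𝓝 L) :=
  exists_tendsto_div_of_superadditive (meanOpt_mono I) (fun _ _ hs ht => meanOpt_add_le I hs ht)
    fun _ ht => meanOpt_le I ht

end MarketLaw

end DynMatch

namespace DynMatch

open scoped ENNReal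

/-! ### Transfer from the market process to the canonical product law -/

section Law

variable {T : Type*} [Fintype T] (I : Instance T)

/-- The laws of the interarrival times and of the sojourn times. -/
noncomputable def coordLaw : (T × ℕ) ⊕ (T × ℕ) → Measure ℝ :=
  Sum.elim (fun p => expMeasure (I.arrivalRate p.1)) (fun p => expMeasure (I.abandonRate p.1))

instance isProbabilityMeasure_coordLaw (q : (T × ℕ) ⊕ (T × ℕ)) :
    IsProbabilityMeasure (coordLaw I q) := by
  cases q with
  | inl p => exact isProbabilityMeasure_expMeasure (I.arrivalRate_pos p.1)
  | inr p => exact isProbabilityMeasure_expMeasure (I.abandonRate_pos p.1)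

/-- Independence of the process is stated for one family indexed by a sum type, whereas `marketLaw`
is a nested product. Both give the same mass to cylinders. -/
lemma map_marketLaw_coord :
    (marketLaw I).map (fun z => Sum.elim (fun p : T × ℕ => (z p.1 p.2).1)
      (fun p : T × ℕ => (z p.1 p.2).2)) = Measure.infinitePi (coordLaw I) := by
  classical
  have := fun i => isProbabilityMeasure_expMeasure (I.arrivalRate_pos i)
  have := fun i => isProbabilityMeasure_expMeasure (I.abandonRate_pos i)
  refine Measure.eq_infinitePi _ fun s t ht => ?_
  obtain ⟨t', ht'⟩ : ∃ t' : (T × ℕ) ⊕ (T × ℕ) → Set ℝ,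
    t' = fun q => if q ∈ s then t q else Set.univ := ⟨_, rfl⟩
  have htm : ∀ q, MeasurableSet (t' q) := fun q => by
    rw [ht']
    by_cases h : q ∈ s <;> simp [h, ht]
  -- A common bound on the ranks lets the cylinder be padded to a full rectangle over types and
  -- ranks below `N`.
  obtain ⟨N, hN⟩ : ∃ N, ∀ q ∈ s, Sum.elim Prod.snd Prod.snd q < N := by
    refine ⟨s.sup (Sum.elim Prod.snd Prod.snd) + 1, fun q hq => ?_⟩
    exact Nat.lt_succ_of_le (Finset.le_sup (f := Sum.elim Prod.snd Prod.snd) hq)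
  set R : Finset (T × ℕ) := Finset.univ ×ˢ Finset.range N with hR
  have hsub : s ⊆ R.disjSum R := fun q hq => by
    have := hN q hq
    cases q with
    | inl p => simpa [hR] using this
    | inr p => simpa [hR] using this
  have hprod : ∏ q ∈ s, coordLaw I q (t q) = ∏ q ∈ R.disjSum R, coordLaw I q (t' q) := by
    rw [← Finset.prod_subset hsub (f := fun q => coordLaw I q (t' q))]
    · exact Finset.prod_congr rfl fun q hq => by simp [ht', hq]
    · intro q _ hq
      simp [ht', hq]
  have hmeas : Measurable fun z : T → ℕ → ℝ × ℝ => (Sum.elim (fun p : T × ℕ => (z p.1 p.2).1)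
      (fun p : T × ℕ => (z p.1 p.2).2) : (T × ℕ) ⊕ (T × ℕ) → ℝ) := by
    refine measurable_pi_lambda _ fun q => ?_
    cases q with
    | inl p => simp only [Sum.elim_inl]; fun_prop
    | inr p => simp only [Sum.elim_inr]; fun_prop
  have hpre : (fun z : T → ℕ → ℝ × ℝ => (Sum.elim (fun p : T × ℕ => (z p.1 p.2).1)
      (fun p : T × ℕ => (z p.1 p.2).2) : (T × ℕ) ⊕ (T × ℕ) → ℝ)) ⁻¹' ((s : Set _).pi t) =
      Set.univ.pi fun i => ((Finset.range N : Finset ℕ) : Set ℕ).pi fun k =>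
        t' (Sum.inl (i, k)) ×ˢ t' (Sum.inr (i, k)) := by
    ext z
    simp only [Set.mem_preimage, Set.mem_pi, Set.mem_univ, true_imp_iff, Set.mem_prod]
    constructor
    · intro h i k _
      constructor
      · by_cases hq : Sum.inl (i, k) ∈ s
        · simpa [ht', hq] using h _ hq
        · simp [ht', hq]
      · by_cases hq : Sum.inr (i, k) ∈ s
        · simpa [ht', hq] using h _ hq
        · simp [ht', hq]
    · intro h q hq
      have hk := hN q hq
      have hq' : q ∈ s := hq
      cases q with
      | inl p => simpa [ht', hq'] using (h p.1 p.2 (by simpa using hk)).1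
      | inr p => simpa [ht', hq'] using (h p.1 p.2 (by simpa using hk)).2
  rw [Measure.map_apply hmeas (MeasurableSet.pi (Set.to_countable _) fun q _ => ht q), hpre,
    hprod, marketLaw, Measure.pi_pi, Finset.prod_disjSum, hR, Finset.prod_product,
    Finset.prod_product, ← Finset.prod_mul_distrib]
  refine Finset.prod_congr rfl fun i _ => ?_
  rw [streamLaw, Measure.infinitePi_pi _ (fun k _ => (htm _).prod (htm _)),
    ← Finset.prod_mul_distrib]
  refine Finset.prod_congr rfl fun k _ => ?_
  rw [markLaw, Measure.prod_prod]
  rfl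

variable {Ω : Type*} [MeasurableSpace Ω] {I} {P : Measure Ω} {arr soj : T → ℕ → Ω → ℝ}

lemma IsMarketProcess.hasLaw (h : IsMarketProcess I P arr soj) :
    HasLaw (fun ω i k => (gap (arr i) k ω, soj i k ω)) (marketLaw I) P := by
  have hY : ∀ q, HasLaw (Sum.elim (fun p : T × ℕ => gap (arr p.1) p.2)
      (fun p : T × ℕ => soj p.1 p.2) q) (coordLaw I q) P := by
    intro q
    cases q with
    | inl p => exact h.hasLaw_gap p.1 p.2
    | inr p => exact h.hasLaw_soj p.1 p.2
  have hlaw := h.indep.hasLaw_infinitePi hY (aemeasurable_pi_iff.2 fun q => (hY q).aemeasurable)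
  have hψ : Measurable fun (y : (T × ℕ) ⊕ (T × ℕ) → ℝ) (i : T) (k : ℕ) =>
      (y (Sum.inl (i, k)), y (Sum.inr (i, k))) := by fun_prop
  have hmeas : Measurable fun z : T → ℕ → ℝ × ℝ => (Sum.elim (fun p : T × ℕ => (z p.1 p.2).1)
      (fun p : T × ℕ => (z p.1 p.2).2) : (T × ℕ) ⊕ (T × ℕ) → ℝ) := by
    refine measurable_pi_lambda _ fun q => ?_
    cases q with
    | inl p => simp only [Sum.elim_inl]; fun_prop
    | inr p => simp only [Sum.elim_inr]; fun_prop
  have h2 : HasLaw (fun (y : (T × ℕ) ⊕ (T × ℕ) → ℝ) (i : T) (k : ℕ) =>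
      (y (Sum.inl (i, k)), y (Sum.inr (i, k)))) (marketLaw I)
      (Measure.infinitePi (coordLaw I)) := by
    refine ⟨hψ.aemeasurable, ?_⟩
    rw [← map_marketLaw_coord, Measure.map_map hψ hmeas]
    exact Measure.map_id
  exact h2.comp hlaw

end Law

/-! ### Policies and matchings of the history graph -/

section Policies

variable {T : Type*}

/-- The agent of type `p.1` and rank `p.2`. -/
def agentOf (z : T → ℕ → ℝ × ℝ) (p : T × ℕ) : Agent T :=
  ⟨p.1, arrTime (z p.1) p.2, depTime (z p.1) p.2⟩

/-- The history in terms of interarrival and sojourn times. -/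
def streamHistory (t : ℝ) (z : T → ℕ → ℝ × ℝ) : Set (Agent T) :=
  agentOf z '' {p | arrTime (z p.1) p.2 < t}

lemma history_eq_streamHistory {Ω : Type*} (arr soj : T → ℕ → Ω → ℝ) (t : ℝ) (ω : Ω) :
    history arr soj t ω = streamHistory t fun i k => (gap (arr i) k ω, soj i k ω) := by
  have h : ∀ i k, arrTime (fun k => (gap (arr i) k ω, soj i k ω)) k = arr i k ω := by
    intro i k
    induction k with
    | zero => simp [arrTime, gap]
    | succ k ih => rw [arrTime_succ, ih]; simp [gap]
  ext a
  simp only [history, streamHistory, agentOf, depTime, h, Set.mem_image, Set.mem_ofPred_eq,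
    Prod.exists]
  exact exists_congr fun i => exists_congr fun k => and_congr_right fun _ => eq_comm

lemma Regular.agentOf_injective {z : T → ℕ → ℝ × ℝ} (hz : Regular z) :
    Function.Injective (agentOf z) := by
  rintro ⟨i, k⟩ ⟨j, l⟩ h
  obtain rfl : i = j := congrArg Agent.kind h
  have h2 : arrTime (z i) k = arrTime (z i) l := congrArg Agent.arrival h
  rw [(strictMono_arrTime fun n => ((hz i).1 n).1).injective h2]

variable (I : Instance T)

/-- The matched pairs of a subgraph, the earlier-arriving agent first. -/
def orderedPairs {H : Set (Agent T)} (C : (poolGraph H).Subgraph) : Set (Agent T × Agent T) :=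
  {p | C.Adj p.1 p.2 ∧ p.1.arrival < p.2.arrival}

/-- The total reward of the pairs of a subgraph. -/
noncomputable def pairsReward {H : Set (Agent T)} (C : (poolGraph H).Subgraph) : ℝ :=
  ∑ᶠ p ∈ orderedPairs C, I.reward p.1.kind p.2.kind

lemma Regular.pairsReward_eq {z : T → ℕ → ℝ × ℝ} (hz : Regular z) {H : Set (Agent T)}
    {C : (poolGraph H).Subgraph} {E : Finset ((T × ℕ) × (T × ℕ))}
    (h : orderedPairs C = Prod.map (agentOf z) (agentOf z) '' E) :
    pairsReward I C = indexValue I E := by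
  rw [pairsReward, h, finsum_mem_image
    (hz.agentOf_injective.prodMap hz.agentOf_injective).injOn, finsum_mem_coe_finset]
  rfl

/-- Agents with different labels have different records on regular inputs, so the matched pairs can
be read back as labels. Intersecting intervals mean that the later agent arrives before the earlier
one departs. -/
lemma Regular.exists_valid_of_isMatching [Finite T] {z : T → ℕ → ℝ × ℝ} (hz : Regular z) {t : ℝ}
    {C : (poolGraph (streamHistory t z)).Subgraph} (hC : C.IsMatching) :
    ∃ E, Valid t z E ∧ pairsReward I C = indexValue I E := by
  have hadj : ∀ {a b}, C.Adj a b → a ∈ streamHistory t z ∧ b ∈ streamHistory t z := fun h =>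
    ⟨(C.adj_sub h).1, (C.adj_sub h).2.1⟩
  have huniq : ∀ {a b c}, C.Adj a b → C.Adj a c → b = c := fun h h' =>
    (hC (C.edge_vert h)).unique h h'
  have hlt : ∀ p, agentOf z p ∈ streamHistory t z → arrTime (z p.1) p.2 < t := by
    rintro p ⟨q, hq, hqp⟩
    rwa [hz.agentOf_injective hqp] at hq
  have hfin : {e : (T × ℕ) × (T × ℕ) | (agentOf z e.1, agentOf z e.2) ∈ orderedPairs C}.Finite := by
    have h := hz.finite_setOf_arrTime_lt t
    refine (h.prod h).subset fun e he => ?_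
    exact ⟨hlt _ (hadj he.1).1, hlt _ (hadj he.1).2⟩
  refine ⟨hfin.toFinset, ⟨fun e he e' he' hee => ?_, fun e he => ?_⟩, hz.pairsReward_eq I ?_⟩
  · rw [Set.Finite.mem_toFinset] at he he'
    obtain ⟨p, q⟩ := e
    obtain ⟨p', q'⟩ := e'
    obtain ⟨h1, h2⟩ := he
    obtain ⟨h1', h2'⟩ := he'
    simp only at h1 h2 h1' h2' hee
    rcases hee with rfl | rfl | rfl | rfl
    · rw [hz.agentOf_injective (huniq h1 h1')]
    -- The shared agent would be the earlier one in one pair and the later one in the other; its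
    -- partner is unique, so the two orders contradict each other.
    · rw [huniq h1 h1'.symm] at h2
      exact absurd h2 h2'.asymm
    · rw [huniq h1.symm h1'] at h2
      exact absurd h2 h2'.asymm
    · rw [hz.agentOf_injective (huniq h1.symm h1'.symm)]
  · rw [Set.Finite.mem_toFinset] at he
    obtain ⟨x, hx, hx'⟩ := (C.adj_sub he.1).2.2.2
    exact ⟨he.2, hlt _ (hadj he.1).2, hx'.1.trans hx.2⟩
  · rw [Set.Finite.coe_toFinset]
    ext ⟨a, b⟩
    constructor
    · intro h
      obtain ⟨⟨p, _, rfl⟩, ⟨q, _, rfl⟩⟩ := hadj h.1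
      exact ⟨(p, q), h, rfl⟩
    · rintro ⟨e, he, h⟩
      rw [← h]
      exact he

lemma Valid.exists_isMatching {z : T → ℕ → ℝ × ℝ} (hz : Regular z) {t : ℝ}
    {E : Finset ((T × ℕ) × (T × ℕ))} (hE : Valid t z E) :
    ∃ C : (poolGraph (streamHistory t z)).Subgraph, C.IsMatching ∧
      pairsReward I C = indexValue I E := by
  let A : Agent T → Agent T → Prop := fun a b => ∃ e ∈ E,
    (a = agentOf z e.1 ∧ b = agentOf z e.2) ∨ (a = agentOf z e.2 ∧ b = agentOf z e.1)
  have hsymm : ∀ a b, A a b → A b a := fun a b ⟨e, he, h⟩ => ⟨e, he, h.symm.imp And.symm And.symm⟩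
  have hpool : ∀ e ∈ E, (poolGraph (streamHistory t z)).Adj (agentOf z e.1) (agentOf z e.2) := by
    intro e he
    obtain ⟨h1, h2, h3⟩ := hE.2 e he
    refine ⟨⟨e.1, h1.trans h2, rfl⟩, ⟨e.2, h2, rfl⟩, fun h => ?_,
      arrTime (z e.2.1) e.2.2, ⟨h1.le, h3⟩, ⟨le_rfl, ?_⟩⟩
    · exact absurd (congrArg Agent.arrival h) h1.ne
    · exact le_add_of_nonneg_right ((hz e.2.1).1 e.2.2).2.le
  let C : (poolGraph (streamHistory t z)).Subgraph :=
    { verts := {a | ∃ b, A a b}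
      Adj := A
      adj_sub := by
        rintro a b ⟨e, he, ⟨rfl, rfl⟩ | ⟨rfl, rfl⟩⟩
        · exact hpool e he
        · exact (hpool e he).symm
      edge_vert := fun h => ⟨_, h⟩
      symm := ⟨hsymm⟩ }
  refine ⟨C, ?_, hz.pairsReward_eq I ?_⟩
  · rintro a ⟨b, hab⟩
    refine ⟨b, hab, fun c hac => ?_⟩
    obtain ⟨e, he, h⟩ := hab
    obtain ⟨e', he', h'⟩ := (hac : A a c)
    have key : e = e' := by
      apply hE.1 e he e' he'
      rcases h with ⟨h, _⟩ | ⟨h, _⟩ <;> rcases h' with ⟨h', _⟩ | ⟨h', _⟩ <;>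
        simp [hz.agentOf_injective (h.symm.trans h')]
    subst key
    have hne : agentOf z e.1 ≠ agentOf z e.2 := (hpool e he).ne
    rcases h with ⟨h, hb⟩ | ⟨h, hb⟩ <;> rcases h' with ⟨h', hc⟩ | ⟨h', hc⟩
    · rw [hb, hc]
    · exact absurd (h.symm.trans h') hne
    · exact absurd (h'.symm.trans h) hne
    · rw [hb, hc]
  · ext ⟨a, b⟩
    constructor
    · rintro ⟨⟨e, he, ⟨rfl, rfl⟩ | ⟨rfl, rfl⟩⟩, hlt⟩
      · exact ⟨e, he, rfl⟩
      · exact absurd hlt (hE.2 e he).1.asymm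
    · rintro ⟨e, he, h⟩
      obtain ⟨rfl, rfl⟩ := Prod.mk.inj h
      exact ⟨⟨e, he, Or.inl ⟨rfl, rfl⟩⟩, (hE.2 e he).1⟩

/-- Maximizers are chosen separately for each history, with the empty matching where none exists. No
measurability is imposed: the total reward agrees almost surely with the measurable `optReward`. -/
lemma exists_optimalPolicy : ∃ π : Policy T, ∀ (H : Set (Agent T)) (C : (poolGraph H).Subgraph),
    C.IsMatching → (∀ C' : (poolGraph H).Subgraph, C'.IsMatching →
      pairsReward I C' ≤ pairsReward I C) → π.totalReward I H = pairsReward I C := by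
  classical
  have h : ∀ H : Set (Agent T), ∃ C : (poolGraph H).Subgraph, C.IsMatching ∧
      ∀ C₀ : (poolGraph H).Subgraph, C₀.IsMatching → (∀ C' : (poolGraph H).Subgraph,
        C'.IsMatching → pairsReward I C' ≤ pairsReward I C₀) →
        pairsReward I C = pairsReward I C₀ := by
    intro H
    by_cases hH : ∃ C₀ : (poolGraph H).Subgraph, C₀.IsMatching ∧
      ∀ C' : (poolGraph H).Subgraph, C'.IsMatching → pairsReward I C' ≤ pairsReward I C₀
    · obtain ⟨C, hC, hmax⟩ := hH
      exact ⟨C, hC, fun C₀ hC₀ hmax₀ => le_antisymm (hmax₀ C hC) (hmax C₀ hC₀)⟩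
    · exact ⟨⊥, fun v hv => hv.elim, fun C₀ hC₀ hmax₀ => absurd ⟨C₀, hC₀, hmax₀⟩ hH⟩
  choose C hC hmax using h
  exact ⟨⟨C, hC⟩, fun H C₀ hC₀ hmax₀ => hmax H C₀ hC₀ hmax₀⟩

lemma Regular.totalReward_le [Finite T] {z : T → ℕ → ℝ × ℝ} (hz : Regular z) (t : ℝ)
    (π : Policy T) : π.totalReward I (streamHistory t z) ≤ optReward I t z := by
  obtain ⟨E, hE, h⟩ := hz.exists_valid_of_isMatching I (π.isMatching (streamHistory t z))
  exact le_trans (le_of_eq h) (hz.indexValue_le I hE)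

lemma Regular.exists_maximal_isMatching [Finite T] {z : T → ℕ → ℝ × ℝ} (hz : Regular z) (t : ℝ) :
    ∃ C : (poolGraph (streamHistory t z)).Subgraph, C.IsMatching ∧
      pairsReward I C = optReward I t z ∧ ∀ C' : (poolGraph (streamHistory t z)).Subgraph,
        C'.IsMatching → pairsReward I C' ≤ pairsReward I C := by
  obtain ⟨E, hE, h, hmax⟩ := hz.exists_optReward I t
  obtain ⟨C, hC, hCE⟩ := hE.exists_isMatching I hz
  refine ⟨C, hC, hCE.trans h.symm, fun C' hC' => ?_⟩
  obtain ⟨E', hE', h'⟩ := hz.exists_valid_of_isMatching I hC'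
  rw [h', hCE]
  exact hmax E' hE'

variable {I} [Fintype T] {Ω : Type*} [MeasurableSpace Ω] {P : Measure Ω}
  {arr soj : T → ℕ → Ω → ℝ}

lemma IsMarketProcess.isGreatest_policyValues (h : IsMarketProcess I P arr soj) {t : ℝ}
    (ht : 0 < t) : IsGreatest (policyValues I P arr soj t) (1 / t * meanOpt I t) := by
  have hlaw := h.hasLaw
  have hreg : ∀ᵐ ω ∂P, Regular fun i k => (gap (arr i) k ω, soj i k ω) := by
    refine ae_of_ae_map hlaw.aemeasurable ?_
    rw [hlaw.map_eq]
    exact ae_regular I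
  have hint : Integrable (fun ω => optReward I t fun i k => (gap (arr i) k ω, soj i k ω)) P := by
    have h1 := integrable_optReward I t
    rw [← hlaw.map_eq] at h1
    exact h1.comp_aemeasurable hlaw.aemeasurable
  have hmean : ∫ ω, optReward I t (fun i k => (gap (arr i) k ω, soj i k ω)) ∂P = meanOpt I t :=
    hlaw.integral_comp (measurable_optReward I t).aestronglyMeasurable
  constructor
  · obtain ⟨π, hπ⟩ := exists_optimalPolicy I
    have hae : (fun ω => optReward I t fun i k => (gap (arr i) k ω, soj i k ω)) =ᵐ[P]
        fun ω => π.totalReward I (history arr soj t ω) := by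
      filter_upwards [hreg] with ω hω
      obtain ⟨C, hC, hCv, hmax⟩ := hω.exists_maximal_isMatching I t
      rw [history_eq_streamHistory, hπ _ C hC hmax, hCv]
    refine ⟨π, hint.congr hae, ?_⟩
    rw [policyValue, ← hmean, integral_congr_ae hae]
  · rintro v ⟨π, hπ, rfl⟩
    rw [policyValue, ← hmean]
    refine mul_le_mul_of_nonneg_left (integral_mono_ae hπ hint ?_) (by positivity)
    filter_upwards [hreg] with ω hω
    rw [history_eq_streamHistory]
    exact hω.totalReward_le I t π

end Policies

end DynMatch

namespace DynMatch

open scoped ENNReal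

/-! ### Agents without a possible partner -/

section Lonely

variable {T : Type*}

/-- The `k`-th agent of type `j` meets no agent of a type in `S` at arrival, and no agent of a type
in `S'` arrives during the agent's sojourn. -/
def Lonely (S S' : Finset T) (j : T) (k : ℕ) (z : T → ℕ → ℝ × ℝ) : Prop :=
  (∀ i ∈ S, ∀ n, arrTime (z i) n < arrTime (z j) k → depTime (z i) n < arrTime (z j) k) ∧
    ∀ i ∈ S', ∀ n, arrTime (z j) k < arrTime (z i) n → depTime (z j) k < arrTime (z i) n

lemma measurableSet_lonely [Countable T] (S S' : Finset T) (j : T) (k : ℕ) :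
    MeasurableSet {z | Lonely S S' j k z} := by
  have ha : ∀ (i : T) (n : ℕ), Measurable fun z : T → ℕ → ℝ × ℝ => arrTime (z i) n := fun i n =>
    (measurable_arrTime n).comp (measurable_pi_apply i)
  have hd : ∀ (i : T) (n : ℕ), Measurable fun z : T → ℕ → ℝ × ℝ => depTime (z i) n := fun i n =>
    (measurable_depTime n).comp (measurable_pi_apply i)
  refine measurableSet_setOfPred.2 (Measurable.and ?_ ?_)
  · exact Measurable.forall fun i => Measurable.imp measurable_const (Measurable.forall fun n =>
      Measurable.imp (measurableSet_setOfPred.1 (measurableSet_lt (ha i n) (ha j k)))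
        (measurableSet_setOfPred.1 (measurableSet_lt (hd i n) (ha j k))))
  · exact Measurable.forall fun i => Measurable.imp measurable_const (Measurable.forall fun n =>
      Measurable.imp (measurableSet_setOfPred.1 (measurableSet_lt (ha j k) (ha i n)))
        (measurableSet_setOfPred.1 (measurableSet_lt (hd j k) (ha i n))))

variable (I : Instance T)

open Classical in
/-- The arrival rate of type `i`, if `i ∈ S`. -/
noncomputable def rateIn (S : Finset T) (i : T) : ℝ := if i ∈ S then I.arrivalRate i else 0

variable [Fintype T]

/-- Resampling the stream of type `j` independently preserves the law. This allows conditioning on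
that stream while the others keep their product law. -/
lemma measurePreserving_update [DecidableEq T] (j : T) :
    MeasurePreserving (fun p : (ℕ → ℝ × ℝ) × (T → ℕ → ℝ × ℝ) => Function.update p.2 j p.1)
      ((streamLaw I j).prod (marketLaw I)) (marketLaw I) := by
  have hm : Measurable fun p : (ℕ → ℝ × ℝ) × (T → ℕ → ℝ × ℝ) => Function.update p.2 j p.1 := by
    refine measurable_pi_lambda _ fun i => ?_
    by_cases h : i = j
    · subst h
      simpa using measurable_fst
    · simp only [Function.update_of_ne h]
      exact (measurable_pi_apply i).comp measurable_snd
  refine ⟨hm, ?_⟩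
  symm
  refine Measure.pi_eq fun s hs => ?_
  rw [Measure.map_apply hm (MeasurableSet.univ_pi hs)]
  have h : (fun p : (ℕ → ℝ × ℝ) × (T → ℕ → ℝ × ℝ) => Function.update p.2 j p.1) ⁻¹'
      Set.univ.pi s = s j ×ˢ Set.univ.pi (Function.update s j Set.univ) := by
    ext ⟨y, z⟩
    simp only [Set.mem_preimage, Set.mem_pi, Set.mem_univ, true_imp_iff, Set.mem_prod]
    constructor
    · refine fun h => ⟨by simpa using h j, fun i => ?_⟩
      by_cases hi : i = j
      · subst hi
        simp
      · simpa [Function.update_of_ne hi] using h i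
    · rintro ⟨h1, h2⟩ i
      by_cases hi : i = j
      · subst hi
        simpa using h1
      · simpa [Function.update_of_ne hi] using h2 i
  rw [h, Measure.prod_prod, marketLaw, Measure.pi_pi,
    ← Finset.mul_prod_erase Finset.univ _ (Finset.mem_univ j),
    ← Finset.mul_prod_erase Finset.univ (fun i => streamLaw I i (s i)) (Finset.mem_univ j)]
  simp only [Function.update_self, measure_univ, one_mul]
  congr 1
  refine Finset.prod_congr rfl fun i hi => ?_
  rw [Function.update_of_ne (Finset.ne_of_mem_erase hi)]

lemma marketLaw_apply_update [DecidableEq T] (j : T) {A : Set (T → ℕ → ℝ × ℝ)}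
    (hA : MeasurableSet A) :
    marketLaw I A = ∫⁻ y, marketLaw I {z | Function.update z j y ∈ A} ∂streamLaw I j := by
  have h := measurePreserving_update I j
  rw [← h.measure_preimage hA.nullMeasurableSet, Measure.prod_apply (h.measurable hA)]
  rfl

open Classical in
/-- The mean number of agents of type `i` present in the long run, if `i ∈ S`. -/
noncomputable def load (S : Finset T) (i : T) : ℝ :=
  if i ∈ S then I.arrivalRate i / I.abandonRate i else 0

lemma sum_load (S : Finset T) : ∑ i, load I S i = ∑ i ∈ S, I.arrivalRate i / I.abandonRate i := by
  classical
  simp [load]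

lemma sum_rateIn (S : Finset T) : ∑ i, rateIn I S i = ∑ i ∈ S, I.arrivalRate i := by
  classical
  simp [rateIn]

/-- A lower bound of the probability that an agent with sojourn time `p.1` who arrives `p.2` before
the next one of the same type `j` meets no agents of other types in `S`, `S'` when alone with
respect to type `j`. -/
noncomputable def lonelyBound (S S' : Finset T) (j : T) [DecidableEq T] (p : ℝ × ℝ) : ℝ≥0∞ :=
  {p : ℝ × ℝ | j ∈ S' → p.1 < p.2}.indicator 1 p *
    ENNReal.ofReal (Real.exp (-∑ i ∈ Finset.univ.erase j, (rateIn I S' i * p.1 + load I S i)))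

lemma measurable_lonelyBound [DecidableEq T] (S S' : Finset T) (j : T) :
    Measurable (lonelyBound I S S' j) := by
  have : MeasurableSet {p : ℝ × ℝ | j ∈ S' → p.1 < p.2} :=
    measurableSet_setOfPred.2 (Measurable.imp measurable_const
      (measurableSet_setOfPred.1 (measurableSet_lt (by fun_prop) (by fun_prop))))
  exact (measurable_one.indicator this).mul (by fun_prop)

/-- With the stream of type `j` fixed, the conditions on type `j` itself are deterministic: earlier
agents are gone, and the next interarrival time exceeds the sojourn time. The conditions on the
other types follow from independent void events at the time of arrival. -/
lemma marketLaw_update_lonely_ge [DecidableEq T] (S S' : Finset T) (j : T) (k : ℕ) (t : ℝ)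
    {y : ℕ → ℝ × ℝ} (hy : ∀ n, 0 < (y n).1 ∧ 0 < (y n).2) :
    (Set.Iio t).indicator 1 (arrTime y k) * lonelyBound I S S' j ((y k).2, (y (k + 1)).1) *
      goneBefore (j ∈ S) k y ≤
    marketLaw I {z | Function.update z j y ∈ {z | arrTime (z j) k < t ∧ Lonely S S' j k z}} := by
  by_cases h1 : arrTime y k < t
  swap
  · rw [Set.indicator_of_notMem (show arrTime y k ∉ Set.Iio t from h1)]
    simp
  by_cases h2 : j ∈ S' → (y k).2 < (y (k + 1)).1
  swap
  · rw [lonelyBound, Set.indicator_of_notMem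
      (show ((y k).2, (y (k + 1)).1) ∉ {p : ℝ × ℝ | j ∈ S' → p.1 < p.2} from h2)]
    simp
  by_cases h3 : j ∈ S → ∀ n < k, depTime y n < arrTime y k
  swap
  · rw [goneBefore, Set.indicator_of_notMem
      (show y ∉ {z | j ∈ S → ∀ n < k, depTime z n < arrTime z k} from h3)]
    simp
  have hmono := strictMono_arrTime fun n => (hy n).1
  have hpos := arrTime_pos (fun n => (hy n).1) k
  rw [Set.indicator_of_mem (show arrTime y k ∈ Set.Iio t from h1), lonelyBound,
    Set.indicator_of_mem
      (show ((y k).2, (y (k + 1)).1) ∈ {p : ℝ × ℝ | j ∈ S' → p.1 < p.2} from h2), goneBefore,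
    Set.indicator_of_mem (show y ∈ {z | j ∈ S → ∀ n < k, depTime z n < arrTime z k} from h3)]
  simp only [Pi.one_apply, one_mul, mul_one]
  -- Silence is required after the arrival only of types in `S'`, and for the length of the sojourn.
  obtain ⟨c, hc⟩ : ∃ c : T → ℝ, c = fun i => if i ∈ S' then (y k).2 else 0 := ⟨_, rfl⟩
  have hc0 : ∀ i, 0 ≤ c i := fun i => by
    rw [hc]
    dsimp only
    split_ifs
    exacts [(hy k).2.le, le_rfl]
  -- The coordinate `j` is left free because it is overwritten by `y`.
  obtain ⟨B, hB⟩ : ∃ B : T → Set (ℕ → ℝ × ℝ),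
    B = Function.update (fun i => ⋃ n, voidEvent (i ∈ S) (arrTime y k) (c i) n) j Set.univ :=
    ⟨_, rfl⟩
  have hle : ENNReal.ofReal (Real.exp (-∑ i ∈ Finset.univ.erase j,
      (rateIn I S' i * (y k).2 + load I S i))) ≤ marketLaw I (Set.univ.pi B) := by
    rw [marketLaw, Measure.pi_pi, ← Finset.mul_prod_erase Finset.univ _ (Finset.mem_univ j), hB,
      Function.update_self, measure_univ, one_mul, ← Finset.sum_neg_distrib, Real.exp_sum,
      ENNReal.ofReal_prod_of_nonneg fun _ _ => (Real.exp_pos _).le]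
    refine Finset.prod_le_prod' fun i hi => ?_
    rw [Function.update_of_ne (Finset.ne_of_mem_erase hi)]
    refine le_trans (le_of_eq ?_) (streamLaw_iUnion_voidEvent_ge I i (i ∈ S) hpos.le (hc0 i))
    rw [← Real.exp_add]
    have h4 : rateIn I S' i * (y k).2 = I.arrivalRate i * c i := by
      rw [hc, rateIn]
      by_cases h : i ∈ S' <;> simp [h]
    rw [h4, neg_add, load]
    congr
  refine hle.trans (measure_mono_ae ?_)
  filter_upwards [ae_regular I] with z hz hzB
  have hzB' : ∀ i, i ≠ j → ∃ n, z i ∈ voidEvent (i ∈ S) (arrTime y k) (c i) n := by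
    intro i hi
    have := hzB i (Set.mem_univ i)
    rw [hB, Function.update_of_ne hi] at this
    exact Set.mem_iUnion.1 this
  refine ⟨by simpa using h1, fun i hi n hn => ?_, fun i hi n hn => ?_⟩
  · by_cases hij : i = j
    · subst hij
      rw [Function.update_self] at hn ⊢
      exact h3 hi n (hmono.lt_iff_lt.1 hn)
    · rw [Function.update_self, Function.update_of_ne hij] at hn ⊢
      obtain ⟨m, hm1, hm2⟩ := hzB' i hij
      have hmono' := strictMono_arrTime fun n => ((hz i).1 n).1
      have hnm : n < m := by
        by_contra hnm
        have h4 := hmono'.monotone (not_lt.1 hnm)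
        have h5 := hc0 i
        linarith
      exact (hm1 n hnm).2 hi
  · by_cases hij : i = j
    · subst hij
      rw [Function.update_self] at hn ⊢
      have h4 := hmono.monotone (Nat.succ_le_of_lt (hmono.lt_iff_lt.1 hn))
      rw [Nat.succ_eq_add_one, arrTime_succ] at h4
      have h5 := h2 hi
      unfold depTime
      linarith
    · rw [Function.update_self, Function.update_of_ne hij] at hn ⊢
      obtain ⟨m, hm1, hm2⟩ := hzB' i hij
      have hmono' := strictMono_arrTime fun n => ((hz i).1 n).1
      have hmn : m ≤ n := by
        by_contra hnm
        exact absurd (hm1 n (not_le.1 hnm)).1 (not_lt.2 hn.le)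
      have h4 := hmono'.monotone hmn
      have h5 : c i = (y k).2 := by rw [hc]; simp [hi]
      unfold depTime
      linarith

/-- Up to the factor `m / (m + a)`, the integrand is the density of an exponential law of rate `m +
a`. -/
lemma lintegral_exp_neg_expMeasure {m a : ℝ} (hm : 0 < m) (ha : 0 ≤ a) :
    ∫⁻ s, ENNReal.ofReal (Real.exp (-(a * s))) ∂expMeasure m = ENNReal.ofReal (m / (m + a)) := by
  have := isProbabilityMeasure_expMeasure (r := m + a) (by positivity)
  have h := lintegral_expMeasure (m + a) (f := fun _ => 1) measurable_const
  simp only [lintegral_const, measure_univ, mul_one] at h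
  rw [lintegral_expMeasure _ (by fun_prop)]
  calc _ = ∫⁻ s in Set.Ioi 0, ENNReal.ofReal (m / (m + a)) *
        ENNReal.ofReal ((m + a) * Real.exp (-((m + a) * s))) := by
        refine lintegral_congr fun s => ?_
        rw [← ENNReal.ofReal_mul (by positivity), ← ENNReal.ofReal_mul (by positivity)]
        congr 1
        rw [add_mul m a s, neg_add, Real.exp_add]
        field_simp
    _ = _ := by
        rw [lintegral_const_mul' _ _ ENNReal.ofReal_ne_top, ← h, mul_one]

/-- If `j ∈ S'`, the event that the next interarrival time of type `j` exceeds `s` supplies the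
factor `exp (-(λ_j s))` missing from the sum over the other types. The Laplace transform of the
sojourn time does the rest. -/
lemma lintegral_lonelyBound [DecidableEq T] (S S' : Finset T) (j : T) :
    ∫⁻ s, ∫⁻ g, lonelyBound I S S' j (s, g) ∂expMeasure (I.arrivalRate j)
      ∂expMeasure (I.abandonRate j) =
    ENNReal.ofReal (I.abandonRate j / (I.abandonRate j + ∑ i ∈ S', I.arrivalRate i)) *
      ENNReal.ofReal (Real.exp (-∑ i ∈ Finset.univ.erase j, load I S i)) := by
  have hl := I.arrivalRate_pos j
  have hm := I.abandonRate_pos j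
  have := isProbabilityMeasure_expMeasure hl
  rw [← lintegral_exp_neg_expMeasure hm
    (Finset.sum_nonneg fun i _ => (I.arrivalRate_pos i).le),
    ← lintegral_mul_const' _ _ ENNReal.ofReal_ne_top]
  refine lintegral_congr_ae ?_
  filter_upwards [ae_pos_expMeasure hm] with s hs
  have h0 : MeasurableSet {g : ℝ | j ∈ S' → s < g} :=
    measurableSet_setOfPred.2 (Measurable.imp measurable_const
      (measurableSet_setOfPred.1 (measurableSet_lt (by fun_prop) (by fun_prop))))
  have h1 : expMeasure (I.arrivalRate j) {g : ℝ | j ∈ S' → s < g} =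
      ENNReal.ofReal (Real.exp (-(rateIn I S' j * s))) := by
    unfold rateIn
    split_ifs with h
    · simp only [h, true_imp_iff]
      exact expMeasure_Ioi hl hs.le
    · simp [h]
  unfold lonelyBound
  dsimp only
  rw [lintegral_mul_const' _ _ ENNReal.ofReal_ne_top]
  have h2 : ∫⁻ g, {p : ℝ × ℝ | j ∈ S' → p.1 < p.2}.indicator (1 : ℝ × ℝ → ℝ≥0∞) (s, g)
      ∂expMeasure (I.arrivalRate j) = expMeasure (I.arrivalRate j) {g : ℝ | j ∈ S' → s < g} := by
    rw [← lintegral_indicator_one h0]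
    rfl
  rw [h2, h1, ← ENNReal.ofReal_mul (Real.exp_pos _).le, ← ENNReal.ofReal_mul (Real.exp_pos _).le,
    ← Real.exp_add, ← Real.exp_add, ← sum_rateIn, ← Finset.add_sum_erase _ _ (Finset.mem_univ j),
    Finset.sum_add_distrib, ← Finset.sum_mul]
  congr 2
  ring

/-- A lower bound of the expected number of lonely agents of type `j` by time `t`. -/
lemma tsum_marketLaw_lonely_ge (S S' : Finset T) (j : T) (t : ℝ) :
    ENNReal.ofReal (I.arrivalRate j * (I.abandonRate j / (I.abandonRate j +
      ∑ i ∈ S', I.arrivalRate i) * Real.exp (-∑ i ∈ S, I.arrivalRate i / I.abandonRate i))) *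
      ENNReal.ofReal t ≤
    ∑' k, marketLaw I {z | arrTime (z j) k < t ∧ Lonely S S' j k z} := by
  classical
  have hl := I.arrivalRate_pos j
  have hm := I.abandonRate_pos j
  have hsum : 0 ≤ ∑ i ∈ S', I.arrivalRate i :=
    Finset.sum_nonneg fun i _ => (I.arrivalRate_pos i).le
  have h1 := tsum_goneBefore_ge I j (j ∈ S) t (measurable_lonelyBound I S S' j)
  rw [lintegral_lonelyBound] at h1
  have h2 : ENNReal.ofReal (I.abandonRate j / (I.abandonRate j + ∑ i ∈ S', I.arrivalRate i)) *
      ENNReal.ofReal (Real.exp (-∑ i ∈ Finset.univ.erase j, load I S i)) *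
      (ENNReal.ofReal (I.arrivalRate j * Real.exp (-load I S j)) * ENNReal.ofReal t) =
      ENNReal.ofReal (I.arrivalRate j * (I.abandonRate j / (I.abandonRate j +
      ∑ i ∈ S', I.arrivalRate i) * Real.exp (-∑ i ∈ S, I.arrivalRate i / I.abandonRate i))) *
      ENNReal.ofReal t := by
    rw [← mul_assoc, ← ENNReal.ofReal_mul (by positivity), ← ENNReal.ofReal_mul (by positivity),
      ← sum_load, ← Finset.add_sum_erase _ _ (Finset.mem_univ j), neg_add, Real.exp_add]
    congr 2
    ring
  rw [← h2]
  refine le_trans (le_of_eq ?_) (h1.trans (ENNReal.tsum_le_tsum fun k => ?_))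
  · unfold load
    congr!
  · have hA : MeasurableSet {z : T → ℕ → ℝ × ℝ | arrTime (z j) k < t ∧ Lonely S S' j k z} :=
      (measurableSet_arrTime_lt (j, k) t).inter (measurableSet_lonely S S' j k)
    rw [marketLaw_apply_update I j hA]
    refine lintegral_mono_ae ?_
    filter_upwards [ae_pos_streamLaw I j] with y hy
    exact marketLaw_update_lonely_ge I S S' j k t hy

/-- The number of agents of type `j` before time `t` that are not lonely. -/
noncomputable def metCount (S S' : Finset T) (j : T) (t : ℝ) (z : T → ℕ → ℝ × ℝ) : ℝ≥0∞ :=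
  ∑' k, {z : T → ℕ → ℝ × ℝ | arrTime (z j) k < t ∧ ¬ Lonely S S' j k z}.indicator 1 z

lemma measurableSet_met (S S' : Finset T) (j : T) (k : ℕ) (t : ℝ) :
    MeasurableSet {z : T → ℕ → ℝ × ℝ | arrTime (z j) k < t ∧ ¬ Lonely S S' j k z} :=
  (measurableSet_arrTime_lt (j, k) t).inter (measurableSet_lonely S S' j k).compl

lemma lintegral_metCount_le (S S' : Finset T) (j : T) {t : ℝ} (ht : 0 ≤ t) :
    ∫⁻ z, metCount S S' j t z ∂marketLaw I ≤ ENNReal.ofReal (I.arrivalRate j *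
      (1 - I.abandonRate j / (I.abandonRate j + ∑ i ∈ S', I.arrivalRate i) *
        Real.exp (-∑ i ∈ S, I.arrivalRate i / I.abandonRate i)) * t) := by
  have hl := I.arrivalRate_pos j
  have hm := I.abandonRate_pos j
  have hsum : 0 ≤ ∑ i ∈ S', I.arrivalRate i :=
    Finset.sum_nonneg fun i _ => (I.arrivalRate_pos i).le
  have h1 : ∫⁻ z, metCount S S' j t z ∂marketLaw I =
      ∑' k, marketLaw I {z | arrTime (z j) k < t ∧ ¬ Lonely S S' j k z} := by
    unfold metCount
    rw [lintegral_tsum fun k =>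
      (measurable_one.indicator (measurableSet_met S S' j k t)).aemeasurable]
    exact tsum_congr fun k => lintegral_indicator_one (measurableSet_met S S' j k t)
  -- Lonely and other agents together make up all arrivals of type `j`, of which `λ_j t` are
  -- expected.
  have h2 : ∑' k, marketLaw I {z | arrTime (z j) k < t ∧ ¬ Lonely S S' j k z} +
      ∑' k, marketLaw I {z | arrTime (z j) k < t ∧ Lonely S S' j k z} =
      ENNReal.ofReal (I.arrivalRate j) * ENNReal.ofReal t := by
    rw [← ENNReal.tsum_add, ← tsum_streamLaw_arrTime_lt]
    refine tsum_congr fun k => ?_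
    rw [← marketLaw_arrTime_lt I (j, k) t, add_comm]
    exact measure_inter_add_sdiff _ (measurableSet_lonely S S' j k)
  have h3 := tsum_marketLaw_lonely_ge I S S' j t
  rw [h1]
  set q := I.abandonRate j / (I.abandonRate j + ∑ i ∈ S', I.arrivalRate i) *
    Real.exp (-∑ i ∈ S, I.arrivalRate i / I.abandonRate i) with hq
  have hq0 : 0 ≤ q := by positivity
  have h4 : I.arrivalRate j * (1 - q) * t = I.arrivalRate j * t - I.arrivalRate j * q * t := by ring
  rw [h4, ENNReal.ofReal_sub _ (by positivity), ENNReal.ofReal_mul hl.le,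
    ENNReal.ofReal_mul (p := I.arrivalRate j * q) (by positivity), ← h2]
  refine ENNReal.le_sub_of_add_le_left
    (ENNReal.mul_ne_top ENNReal.ofReal_ne_top ENNReal.ofReal_ne_top) ?_
  rw [add_comm]
  gcongr

end Lonely

/-! ### Feasibility of the matching rates and compactness of the linear programs -/

section OffLP

variable {T : Type*}

open Classical in
/-- The number of pairs of an agent of type `i` and a later one of type `j`. -/
noncomputable def pairCount (E : Finset ((T × ℕ) × (T × ℕ))) (i j : T) : ℝ :=
  (E.filter fun e => e.1.1 = i ∧ e.2.1 = j).card

lemma pairCount_nonneg (E : Finset ((T × ℕ) × (T × ℕ))) (i j : T) : 0 ≤ pairCount E i j :=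
  Nat.cast_nonneg _

lemma pairCount_le_card (E : Finset ((T × ℕ) × (T × ℕ))) (i j : T) : pairCount E i j ≤ E.card := by
  classical
  exact Nat.cast_le.2 (Finset.card_filter_le _ _)

lemma pairCount_eq_sum (E : Finset ((T × ℕ) × (T × ℕ))) (i j : T) [DecidableEq T] :
    pairCount E i j = ∑ e ∈ E, if e.1.1 = i ∧ e.2.1 = j then 1 else 0 := by
  rw [pairCount, ← Finset.natCast_card_filter]
  congr

lemma indexValue_eq [Fintype T] (I : Instance T) (E : Finset ((T × ℕ) × (T × ℕ))) :
    indexValue I E = ∑ i, ∑ j, I.reward i j * pairCount E i j := by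
  classical
  simp_rw [pairCount_eq_sum, Finset.mul_sum]
  rw [indexValue]
  simp_rw [Finset.sum_comm (s := Finset.univ (α := T)) (t := E)]
  refine Finset.sum_congr rfl fun e _ => ?_
  simp [ite_and]

/-- Each counted pair has a type-`j` member that is not lonely: the later one for `S`, the earlier
one for `S'`. These members are distinct, also when both sets contain `j`, since in a matching no
agent occurs in two pairs or in both roles. -/
lemma Valid.sum_pairCount_le [Finite T] {t : ℝ} {z : T → ℕ → ℝ × ℝ}
    {E : Finset ((T × ℕ) × (T × ℕ))} (hE : Valid t z E) (S S' : Finset T) (j : T) :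
    ENNReal.ofReal (∑ i ∈ S, pairCount E i j + ∑ i ∈ S', pairCount E j i) ≤
      metCount S S' j t z := by
  classical
  set E₁ := E.filter fun e => e.1.1 ∈ S ∧ e.2.1 = j
  set E₂ := E.filter fun e => e.1.1 = j ∧ e.2.1 ∈ S'
  have h1 : ∑ i ∈ S, pairCount E i j = E₁.card := by
    simp_rw [pairCount_eq_sum]
    rw [Finset.sum_comm, Finset.card_filter]
    push_cast
    refine Finset.sum_congr rfl fun e _ => ?_
    simp [ite_and]
  have h2 : ∑ i ∈ S', pairCount E j i = E₂.card := by
    simp_rw [pairCount_eq_sum]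
    rw [Finset.sum_comm, Finset.card_filter]
    push_cast
    refine Finset.sum_congr rfl fun e _ => ?_
    simp [ite_and]
  have hinj₁ : Set.InjOn (fun e : (T × ℕ) × (T × ℕ) => e.2.2) E₁ := by
    intro e he e' he' hee
    obtain ⟨hm, _, hj⟩ := Finset.mem_filter.1 he
    obtain ⟨hm', _, hj'⟩ := Finset.mem_filter.1 he'
    exact hE.1 e hm e' hm' (Or.inr (Or.inr (Or.inr (Prod.ext (hj.trans hj'.symm) hee))))
  have hinj₂ : Set.InjOn (fun e : (T × ℕ) × (T × ℕ) => e.1.2) E₂ := by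
    intro e he e' he' hee
    obtain ⟨hm, hj, _⟩ := Finset.mem_filter.1 he
    obtain ⟨hm', hj', _⟩ := Finset.mem_filter.1 he'
    exact hE.1 e hm e' hm' (Or.inl (Prod.ext (hj.trans hj'.symm) hee))
  have hdisj : Disjoint (E₁.image fun e => e.2.2) (E₂.image fun e => e.1.2) := by
    refine Finset.disjoint_left.2 fun k hk hk' => ?_
    obtain ⟨e, he, rfl⟩ := Finset.mem_image.1 hk
    obtain ⟨e', he', hee⟩ := Finset.mem_image.1 hk'
    obtain ⟨he, _, hj⟩ := Finset.mem_filter.1 he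
    obtain ⟨he', hj', _⟩ := Finset.mem_filter.1 he'
    have h3 : e.2 = e'.1 := Prod.ext (hj.trans hj'.symm) hee.symm
    obtain rfl := hE.1 e he e' he' (Or.inr (Or.inr (Or.inl h3)))
    have h4 := (hE.2 e he).1
    rw [h3] at h4
    exact lt_irrefl _ h4
  have hcard : (E₁.card : ℝ) + E₂.card =
      (((E₁.image fun e => e.2.2) ∪ E₂.image fun e => e.1.2).card : ℝ) := by
    rw [Finset.card_union_of_disjoint hdisj, Finset.card_image_of_injOn hinj₁,
      Finset.card_image_of_injOn hinj₂]
    push_cast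
    rfl
  rw [h1, h2, hcard, ENNReal.ofReal_natCast, Finset.card_eq_sum_ones, Nat.cast_sum]
  refine le_trans (Finset.sum_le_sum fun k hk => ?_) (ENNReal.sum_le_tsum
    ((E₁.image fun e => e.2.2) ∪ E₂.image fun e => e.1.2))
  have hmem : z ∈ {z : T → ℕ → ℝ × ℝ | arrTime (z j) k < t ∧ ¬ Lonely S S' j k z} := by
    rcases Finset.mem_union.1 hk with hk | hk
    · obtain ⟨e, he, rfl⟩ := Finset.mem_image.1 hk
      obtain ⟨hm, hi, rfl⟩ := Finset.mem_filter.1 he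
      obtain ⟨h3, h4, h5⟩ := hE.2 e hm
      exact ⟨h4, fun h => absurd (h.1 _ hi _ h3) (not_lt.2 h5)⟩
    · obtain ⟨e, he, rfl⟩ := Finset.mem_image.1 hk
      obtain ⟨hm, rfl, hi⟩ := Finset.mem_filter.1 he
      obtain ⟨h3, h4, h5⟩ := hE.2 e hm
      exact ⟨h3.trans h4, fun h => absurd (h.2 _ hi _ h3) (not_lt.2 h5)⟩
  rw [Set.indicator_of_mem hmem]
  simp

lemma isClosed_feasibleOff (I : Instance T) : IsClosed {x | FeasibleOff I x} := by
  have h : {x | FeasibleOff I x} = (⋂ i, ⋂ j, {x | 0 ≤ x i j}) ∩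
      ⋂ j, ⋂ S : Finset T, ⋂ S' : Finset T, {x | ∑ i ∈ S, x i j + ∑ i ∈ S', x j i ≤
        I.arrivalRate j * (1 - I.abandonRate j / (I.abandonRate j + ∑ i ∈ S', I.arrivalRate i) *
          Real.exp (-∑ i ∈ S, I.arrivalRate i / I.abandonRate i))} := by
    ext x
    simp only [Set.mem_ofPred_eq, Set.mem_inter_iff, Set.mem_iInter]
    exact ⟨fun h => ⟨h.1, h.2⟩, fun h => ⟨h.1, h.2⟩⟩
  rw [h]
  refine IsClosed.inter (isClosed_iInter fun i => isClosed_iInter fun j => ?_)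
    (isClosed_iInter fun j => isClosed_iInter fun S => isClosed_iInter fun S' => ?_)
  · exact isClosed_le (by fun_prop) (by fun_prop)
  · exact isClosed_le (by fun_prop) (by fun_prop)

variable [Fintype T] (I : Instance T)

/-- An optimal matching can be chosen measurably. -/
lemma exists_measurable_optimal (t : ℝ) :
    ∃ (f : ℕ → Finset ((T × ℕ) × (T × ℕ))) (N : (T → ℕ → ℝ × ℝ) → ℕ), Measurable N ∧
      ∀ z, Regular z → Valid t z (f (N z)) ∧ optReward I t z = indexValue I (f (N z)) := by
  classical
  obtain ⟨f, hf⟩ := exists_surjective_nat (Finset ((T × ℕ) × (T × ℕ)))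
  -- The second alternative makes `Nat.find` defined also on irregular inputs, where an optimal
  -- matching may not exist.
  let p : (T → ℕ → ℝ × ℝ) → ℕ → Prop := fun z n =>
    (Valid t z (f n) ∧ optReward I t z = indexValue I (f n)) ∨
      ∀ m, ¬ (Valid t z (f m) ∧ optReward I t z = indexValue I (f m))
  have hp : ∀ z, ∃ n, p z n := fun z => by
    by_cases h : ∃ m, Valid t z (f m) ∧ optReward I t z = indexValue I (f m)
    · exact h.imp fun _ hm => Or.inl hm
    · exact ⟨0, Or.inr (not_exists.1 h)⟩
  have hm : ∀ n, MeasurableSet {z | Valid t z (f n) ∧ optReward I t z = indexValue I (f n)} :=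
    fun n => (measurableSet_valid t (f n)).inter
      ((measurable_optReward I t) (measurableSet_singleton (indexValue I (f n))))
  refine ⟨f, fun z => Nat.find (hp z), measurable_find hp fun n => ?_, fun z hz => ?_⟩
  · refine measurableSet_setOfPred.2 (Measurable.or (measurableSet_setOfPred.1 (hm n))
      (Measurable.forall fun m => Measurable.not (measurableSet_setOfPred.1 (hm m))))
  · obtain ⟨E, hE, h, _⟩ := hz.exists_optReward I t
    obtain ⟨m, rfl⟩ := hf E
    exact (Nat.find_spec (hp z)).resolve_right fun h' => h' m ⟨hE, h⟩

/-- The rates at which an optimal matching pairs the types are feasible for the linear program. -/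
lemma exists_feasibleOff {t : ℝ} (ht : 0 < t) :
    ∃ x, FeasibleOff I x ∧ objective I x = 1 / t * meanOpt I t := by
  obtain ⟨f, N, hN, hopt⟩ := exists_measurable_optimal I t
  have hmeas : ∀ i j, Measurable fun z => pairCount (f (N z)) i j := fun i j =>
    (measurable_from_nat (f := fun n => pairCount (f n) i j)).comp hN
  have hint : ∀ i j, Integrable (fun z => pairCount (f (N z)) i j) (marketLaw I) := by
    intro i j
    refine (integrable_arrivalCount I t).mono' (hmeas i j).aestronglyMeasurable ?_
    filter_upwards [ae_regular I] with z hz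
    rw [Real.norm_of_nonneg (pairCount_nonneg _ _ _)]
    exact (pairCount_le_card _ _ _).trans ((hopt z hz).1.card_le_toReal hz)
  refine ⟨fun i j => 1 / t * ∫ z, pairCount (f (N z)) i j ∂marketLaw I,
    ⟨fun i j => ?_, fun j S S' => ?_⟩, ?_⟩
  · exact mul_nonneg (by positivity) (integral_nonneg fun z => pairCount_nonneg _ _ _)
  · have hl := I.arrivalRate_pos j
    have hm := I.abandonRate_pos j
    have hsum : 0 ≤ ∑ i ∈ S', I.arrivalRate i :=
      Finset.sum_nonneg fun i _ => (I.arrivalRate_pos i).le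
    have hq : 0 ≤ 1 - I.abandonRate j / (I.abandonRate j + ∑ i ∈ S', I.arrivalRate i) *
        Real.exp (-∑ i ∈ S, I.arrivalRate i / I.abandonRate i) := by
      refine sub_nonneg.2 (mul_le_one₀ ?_ (Real.exp_pos _).le ?_)
      · exact (div_le_one (by positivity)).2 (by linarith)
      · rw [Real.exp_le_one_iff, neg_nonpos]
        exact Finset.sum_nonneg fun i _ => (div_pos (I.arrivalRate_pos i)
          (I.abandonRate_pos i)).le
    have hint1 : Integrable (fun z => ∑ i ∈ S, pairCount (f (N z)) i j) (marketLaw I) :=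
      integrable_finsetSum _ fun i _ => hint i j
    have hint2 : Integrable (fun z => ∑ i ∈ S', pairCount (f (N z)) j i) (marketLaw I) :=
      integrable_finsetSum _ fun i _ => hint j i
    rw [← Finset.mul_sum, ← Finset.mul_sum, ← mul_add,
      ← integral_finsetSum _ fun i _ => hint i j, ← integral_finsetSum _ fun i _ => hint j i,
      ← integral_add hint1 hint2, one_div, inv_mul_le_iff₀ ht, mul_comm t]
    rw [integral_eq_lintegral_of_nonneg_ae (ae_of_all _ fun z => add_nonneg
      (Finset.sum_nonneg fun _ _ => pairCount_nonneg _ _ _)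
      (Finset.sum_nonneg fun _ _ => pairCount_nonneg _ _ _)) (hint1.add hint2).1]
    refine ENNReal.toReal_le_of_le_ofReal (by positivity)
      (le_trans (lintegral_mono_ae ?_) (lintegral_metCount_le I S S' j ht.le))
    filter_upwards [ae_regular I] with z hz
    exact (hopt z hz).1.sum_pairCount_le S S' j
  · have h1 : meanOpt I t =
        ∫ z, ∑ i, ∑ j, I.reward i j * pairCount (f (N z)) i j ∂marketLaw I := by
      refine integral_congr_ae ?_
      filter_upwards [ae_regular I] with z hz
      rw [(hopt z hz).2, indexValue_eq]
    rw [h1, integral_finsetSum _ fun i _ => integrable_finsetSum _ fun j _ =>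
      (hint i j).const_mul _, objective, Finset.mul_sum]
    refine Finset.sum_congr rfl fun i _ => ?_
    rw [integral_finsetSum _ fun j _ => (hint i j).const_mul _, Finset.mul_sum]
    refine Finset.sum_congr rfl fun j _ => ?_
    rw [integral_const_mul]
    ring

lemma continuous_objective : Continuous (objective I) := by
  unfold objective
  fun_prop

lemma isClosed_feasibleRelaxed : IsClosed {x | FeasibleRelaxed I x} := by
  have h : {x | FeasibleRelaxed I x} = (⋂ i, ⋂ j, {x | 0 ≤ x i j}) ∩
      ((⋂ j, {x | ∑ i, x i j + ∑ i, x j i ≤ I.arrivalRate j}) ∩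
      ⋂ j, ⋂ S : Finset T, {x | ∑ i ∈ S, x i j ≤ I.arrivalRate j *
        (1 - Real.exp (-∑ i ∈ S, I.arrivalRate i / I.abandonRate i))}) := by
    ext x
    simp only [Set.mem_ofPred_eq, Set.mem_inter_iff, Set.mem_iInter]
    exact ⟨fun h => ⟨h.1, h.2, h.3⟩, fun h => ⟨h.1, h.2.1, h.2.2⟩⟩
  rw [h]
  refine IsClosed.inter (isClosed_iInter fun i => isClosed_iInter fun j => ?_)
    (IsClosed.inter (isClosed_iInter fun j => ?_)
      (isClosed_iInter fun j => isClosed_iInter fun S => ?_))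
  · exact isClosed_le (by fun_prop) (by fun_prop)
  · exact isClosed_le (by fun_prop) (by fun_prop)
  · exact isClosed_le (by fun_prop) (by fun_prop)

variable {I}

/-- The balance constraint is the case `S = S' = univ` with the subtracted product dropped; the
other one is the case `S' = ∅`, where the fraction equals `1`. -/
lemma FeasibleOff.relaxed {x : T → T → ℝ} (hx : FeasibleOff I x) : FeasibleRelaxed I x := by
  refine ⟨hx.nonneg, fun j => ?_, fun j S => ?_⟩
  · refine (hx.match_rate j Finset.univ Finset.univ).trans ?_
    have hl := I.arrivalRate_pos j
    have hm := I.abandonRate_pos j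
    have hsum : 0 ≤ ∑ i, I.arrivalRate i :=
      Finset.sum_nonneg fun i _ => (I.arrivalRate_pos i).le
    refine mul_le_of_le_one_right hl.le (sub_le_self _ (by positivity))
  · have h := hx.match_rate j S ∅
    simpa [div_self (I.abandonRate_pos j).ne'] using h

lemma FeasibleRelaxed.le {x : T → T → ℝ} (hx : FeasibleRelaxed I x) (i j : T) :
    x i j ≤ I.arrivalRate j := by
  refine le_trans ?_ (hx.balance j)
  have h1 := Finset.single_le_sum (f := fun i => x i j) (fun i _ => hx.nonneg i j)
    (Finset.mem_univ i)
  have h2 : 0 ≤ ∑ i, x j i := Finset.sum_nonneg fun i _ => hx.nonneg j i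
  linarith

variable (I)

lemma isCompact_feasibleRelaxed : IsCompact {x | FeasibleRelaxed I x} := by
  refine IsCompact.of_isClosed_subset
    (isCompact_univ_pi fun _ : T => isCompact_univ_pi fun j : T =>
      isCompact_Icc (a := (0 : ℝ)) (b := I.arrivalRate j)) (isClosed_feasibleRelaxed I) ?_
  intro x hx i _ j _
  exact ⟨hx.nonneg i j, hx.le i j⟩

lemma isCompact_feasibleOff : IsCompact {x | FeasibleOff I x} :=
  (isCompact_feasibleRelaxed I).of_isClosed_subset (isClosed_feasibleOff I) fun _ hx => hx.relaxed

/-- Compactness gives the maximum; the matching rates at horizon `1` serve as a feasible point. -/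
lemma isGreatest_lpOff : IsGreatest (lpOffValues I) (lpOff I) := by
  obtain ⟨x, hx, _⟩ := exists_feasibleOff I one_pos
  exact ((isCompact_feasibleOff I).image (continuous_objective I)).isGreatest_sSup
    ⟨_, x, hx, rfl⟩

lemma isGreatest_lpRelaxed : IsGreatest (lpRelaxedValues I) (lpRelaxed I) := by
  obtain ⟨x, hx, _⟩ := exists_feasibleOff I one_pos
  exact ((isCompact_feasibleRelaxed I).image (continuous_objective I)).isGreatest_sSup
    ⟨_, x, hx.relaxed, rfl⟩

lemma meanOpt_le_lpOff {t : ℝ} (ht : 0 < t) : 1 / t * meanOpt I t ≤ lpOff I := by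
  obtain ⟨x, hx, h⟩ := exists_feasibleOff I ht
  exact (isGreatest_lpOff I).2 ⟨x, hx, h⟩

lemma lpOff_le_lpRelaxed : lpOff I ≤ lpRelaxed I := by
  obtain ⟨x, hx, h⟩ := (isGreatest_lpOff I).1
  exact (isGreatest_lpRelaxed I).2 ⟨x, hx.relaxed, h⟩

end OffLP

end DynMatch

theorem mainTheorem4 {T Ω : Type*} [Fintype T] [MeasurableSpace Ω]
    (I : DynMatch.Instance T) (P : Measure Ω) [IsProbabilityMeasure P]
    (arr soj : T → ℕ → Ω → ℝ) (hproc : DynMatch.IsMarketProcess I P arr soj) :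
    -- the quantities compared below are well defined: the maxima are attained, the limit exists
    (∀ t : ℝ, 0 < t →
      IsGreatest (DynMatch.policyValues I P arr soj t) (DynMatch.offOptAt I P arr soj t)) ∧
    Tendsto (fun t : ℝ => DynMatch.offOptAt I P arr soj t) atTop
      (𝓝 (DynMatch.offOpt I P arr soj)) ∧
    IsGreatest (DynMatch.lpOffValues I) (DynMatch.lpOff I) ∧
    IsGreatest (DynMatch.lpRelaxedValues I) (DynMatch.lpRelaxed I) ∧
    -- the two inequalities
    DynMatch.offOpt I P arr soj ≤ DynMatch.lpOff I ∧
    DynMatch.lpOff I ≤ DynMatch.lpRelaxed I := by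
  have hval : ∀ t : ℝ, 0 < t →
      DynMatch.offOptAt I P arr soj t = 1 / t * DynMatch.meanOpt I t := fun t ht =>
    (hproc.isGreatest_policyValues ht).csSup_eq
  obtain ⟨L, hL⟩ := DynMatch.exists_tendsto_meanOpt I
  have hlim : Tendsto (fun t : ℝ => DynMatch.offOptAt I P arr soj t) atTop (𝓝 L) := by
    refine hL.congr' ?_
    filter_upwards [eventually_gt_atTop 0] with t ht using (hval t ht).symm
  have hoff : DynMatch.offOpt I P arr soj = L := hlim.limUnder_eq
  refine ⟨fun t ht => ?_, ?_, DynMatch.isGreatest_lpOff I, DynMatch.isGreatest_lpRelaxed I, ?_,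
    DynMatch.lpOff_le_lpRelaxed I⟩
  · rw [hval t ht]
    exact hproc.isGreatest_policyValues ht
  · rwa [hoff]
  · rw [hoff]
    refine le_of_tendsto hL ?_
    filter_upwards [eventually_gt_atTop 0] with t ht using DynMatch.meanOpt_le_lpOff I ht
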